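/- Let $\Sigma$ be an alphabet of constants, finite or countably infinite, and let $X=\{x_0,x_1,x_2,\dots\}$ be a countably infinite alphabet of variables. A word equation is a pair $(\alpha,\beta)$ of non-empty words $\alpha,\beta\in(\Sigma\cup X)^+$, written $\alpha=\beta$. It is satisfiable if there is a morphism $h:(\Sigma\cup X)^*\to\Sigma^*$ with $h(a)=a$ for all $a\in\Sigma$ and $h(\alpha)=h(\beta)$. It is regular-ordered if each variable occurs at most once in $\alpha$ and at most once in $\beta$ and, for all variables $x,y$ that occur in both $\alpha$ and $\beta$, $x$ occurs before $y$ in $\alpha$ if and only if $x$ occurs before $y$ in $\beta$. Theorem. The satisfiability problem for regular-ordered word equations is in $\mathsf{NP}$. That is, the language of all encodings of satisfiable regular-ordered word equations over $\Sigma$ (over a fixed finite alphabet, each constant and each variable being written as a marker followed by its index in binary) belongs to $\mathsf{NP}$. -/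

import Mathlib

namespace WordEq

/-! ### Word equations -/

/-- The alphabet of constants with `k` letters `a₀, a₁, …` (countably many letters if `k = ⊤`). -/
abbrev Letter (k : ℕ∞) : Type := {c : ℕ // (c : ℕ∞) < k}

/-- A symbol of a pattern: a constant from `C`, or one of the variables `x₀, x₁, x₂, …`. -/
inductive Symbol (C : Type) : Type
  | const (a : C)
  | var (x : ℕ)

/-- A pattern: a word over constants and variables. -/
abbrev Pattern (C : Type) : Type := List (Symbol C)

/-- A word equation `lhs = rhs`; both sides are non-empty patterns. -/
structure Equation (C : Type) : Type where
  lhs : Pattern C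
  rhs : Pattern C
  lhs_ne_nil : lhs ≠ []
  rhs_ne_nil : rhs ≠ []

/-- The image of a symbol under the substitution given by the images `h x` of the variables. -/
def Symbol.image {C : Type} (h : ℕ → List C) : Symbol C → List C
  | .const a => [a]
  | .var x => h x

/-- The image of a pattern under the substitution given by `h`, that is, under the unique morphism
of words which fixes the constants and maps each variable `x` to `h x`. -/
def Pattern.image {C : Type} (h : ℕ → List C) (α : Pattern C) : List C :=
  α.flatMap (Symbol.image h)

/-- `α` is regular: each variable has at most one occurrence in `α`. -/
def Pattern.IsRegular {C : Type} (α : Pattern C) : Prop :=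
  ∀ x i j : ℕ, α[i]? = some (.var x) → α[j]? = some (.var x) → i = j

/-- All occurrences of the variable `x` in `α` are before all occurrences of the variable `y`. -/
def Pattern.Before {C : Type} (α : Pattern C) (x y : ℕ) : Prop :=
  ∀ i j : ℕ, α[i]? = some (.var x) → α[j]? = some (.var y) → i < j

namespace Equation

variable {C : Type}

/-- `h` is a solution of the equation. -/
def IsSolution (E : Equation C) (h : ℕ → List C) : Prop :=
  Pattern.image h E.lhs = Pattern.image h E.rhs

/-- The equation has a solution. -/
def IsSatisfiable (E : Equation C) : Prop := ∃ h : ℕ → List C, E.IsSolution h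

/-- Both sides of the equation are regular. -/
def IsRegular (E : Equation C) : Prop :=
  Pattern.IsRegular E.lhs ∧ Pattern.IsRegular E.rhs

/-- Any two variables that both occur in both sides occur in the same order in both sides. -/
def IsOrdered (E : Equation C) : Prop :=
  ∀ x y : ℕ, .var x ∈ E.lhs → .var x ∈ E.rhs → .var y ∈ E.lhs → .var y ∈ E.rhs →
    (Pattern.Before E.lhs x y ↔ Pattern.Before E.rhs x y)

end Equation

/-! ### Word equations as inputs of a machine -/

/-- The finite alphabet in which word equations are written down. -/
inductive Token : Type
  | const
  | var
  | bit (b : Bool)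
  | eq
  deriving DecidableEq, Fintype

/-- A constant or a variable is written as a marker followed by its index in binary (without
superfluous zeros, least significant bit first). -/
def Symbol.encode {k : ℕ∞} : Symbol (Letter k) → List Token
  | .const a => .const :: (Nat.bits a.1).map .bit
  | .var x => .var :: (Nat.bits x).map .bit

/-- A pattern is written symbol by symbol. -/
def Pattern.encode {k : ℕ∞} (α : Pattern (Letter k)) : List Token :=
  α.flatMap Symbol.encode

/-- An equation is written as its left side, an equality sign and its right side. -/
def Equation.encode {k : ℕ∞} (E : Equation (Letter k)) : List Token :=
  Pattern.encode E.lhs ++ .eq :: Pattern.encode E.rhs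

/-- The satisfiability problem for regular-ordered word equations over an alphabet with `k`
constants: the language of all encodings of satisfiable regular-ordered equations. -/
def regularOrderedSat (k : ℕ∞) : Language Token :=
  {w | ∃ E : Equation (Letter k),
    E.IsRegular ∧ E.IsOrdered ∧ E.IsSatisfiable ∧ E.encode = w}

end WordEq

/-! ### The class NP -/

/-- How an input word `x` and a certificate `c` are presented to a verifier: as `x` followed by `c`
on the input stack, the two words being written in disjoint alphabets. -/
def verifierInput {Γ Δ : Type} (q : List Γ × List Δ) : List (Γ ⊕ Δ) :=
  q.1.map Sum.inl ++ q.2.map Sum.inr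

/-- The class NP of languages over a finite alphabet `Γ`: those with a verifier `V`, running in
polynomial time on a deterministic multi-stack Turing machine, such that `x` is in the language iff
`V` accepts `x` together with some certificate of length polynomial in the length of `x`. -/
def NP (Γ : Type) [Finite Γ] : Set (Language Γ) :=
  {L | ∃ (Δ : Type) (_ : Finite Δ) (V : List Γ × List Δ → Bool) (p : Polynomial ℕ),
    Nonempty (Turing.TM2ComputableInPolyTime verifierInput Computability.encodeBool V) ∧
    ∀ x : List Γ, x ∈ L ↔ ∃ c : List Δ, c.length ≤ p.eval x.length ∧ V (x, c) = true}

/-!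
The proof has two parts: a satisfiable regular-ordered equation has a short solution, and a
deterministic multi-stack machine can check a certificate that contains such a solution.

*Short solutions.* Regard every variable and every occurrence of a constant as a block, so that a
solution fills the blocks of two lists in such a way that both lists spell the same word. No block
is repeated in a list, and the common blocks are in the same order in both lists. Take a solution
whose common word is as short as possible. If the two occurrences of a variable block overlapped or
touched, then the block could be shortened by the distance of the occurrences
(`exists_shorter_block`). Now link a position on the left side with the position on the right side
that faces it. The positions of a class of linked positions can be deleted from a solution all at
once (`exists_deletion`), so by minimality every class meets a constant. The links form paths. A
path that leaves a block proceeds in one direction only, since the common blocks are in the same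
order, and so it never returns to that block (`not_transGen_linked`). Hence the positions of a
variable block belong to distinct classes, and there are at most as many of them as there are
blocks (`exists_short_blocks`). All letters of such a solution occur in the equation, so the
solution can be written down in cubic length (`exists_isWitness`).

*Certificates.* The language is presented in the following form: `x` belongs to it iff some word of
polynomial length in a fixed regular language of instructions can be executed on finitely many
stacks, starting with `x` on one of them and ending with all of them empty. Each such language is
in NP (`mem_NP_of_runs`): the machine runs a finite automaton over the certificate while it
performs the instructions, in linear time. The certificates used here read the right side and then
the left side of the equation, annotated with the images of the variables and with the claim for
each variable whether it is common to both sides. Pushing and popping compares the images of the two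
sides, and also the sequences of the common variables with their images, which is where the
equation being ordered enters. What remains is that no variable is repeated in the left side
together with the variables of the right side that are claimed not to be common
(`IsWitness`). This is checked by comparing all pairs of names, where the certificate points at the
first difference of any two of them (`NameInstr.uniqueLang`).
-/

/-! ### Closure properties of regular languages -/

namespace Language

open scoped Computability

variable {α β : Type}

/-- The left quotient of `L * M` by `w` is the union of `L.leftQuotient w * M` with some left
quotients of `M`, so there are only finitely many of them. -/
theorem IsRegular.mul {L M : Language α} (hL : L.IsRegular) (hM : M.IsRegular) :
    (L * M).IsRegular := by
  have hL := hL.finite_range_leftQuotient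
  have hM := hM.finite_range_leftQuotient
  refine .of_finite_range_leftQuotient (((hL.prod hM.powerset).image
    fun q : Language α × Set (Language α) ↦
      {y : List α | y ∈ q.1 * M ∨ ∃ N ∈ q.2, y ∈ N}).subset ?_)
  rintro _ ⟨w, rfl⟩
  refine ⟨(L.leftQuotient w, {N | ∃ u v, u ∈ L ∧ u ++ v = w ∧ M.leftQuotient v = N}),
    ⟨⟨w, rfl⟩, ?_⟩, ?_⟩
  · rintro _ ⟨u, v, -, -, rfl⟩
    exact ⟨v, rfl⟩
  · ext y
    change (y ∈ L.leftQuotient w * M ∨ _) ↔ w ++ y ∈ L * M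
    rw [mem_mul, mem_mul]
    constructor
    · rintro (⟨a, ha, b, hb, rfl⟩ | ⟨_, ⟨u, v, hu, rfl, rfl⟩, hy⟩)
      · exact ⟨w ++ a, ha, b, hb, by simp⟩
      · exact ⟨u, hu, v ++ y, hy, by simp⟩
    · rintro ⟨a, ha, b, hb, h⟩
      rcases List.append_eq_append_iff.1 h with ⟨c, rfl, rfl⟩ | ⟨c, rfl, rfl⟩
      · exact Or.inr ⟨_, ⟨a, c, ha, rfl, rfl⟩, hb⟩
      · exact Or.inl ⟨c, ha, b, hb, rfl⟩

theorem append_mem_kstar_iff {L : Language α} {w y : List α} (hw : w ≠ []) :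
    w ++ y ∈ L∗ ↔ ∃ u v, u ∈ L∗ ∧ u ++ v = w ∧ y ∈ L.leftQuotient v * L∗ := by
  constructor
  · rintro ⟨l, hl, hmem⟩
    induction l generalizing w with
    | nil => simp at hl; exact absurd hl.1 hw
    | cons a l ih =>
      rw [List.flatten_cons] at hl
      have hl' : l.flatten ∈ L∗ := join_mem_kstar fun x hx ↦ hmem x (List.mem_cons_of_mem _ hx)
      have ha : a ∈ L := hmem a List.mem_cons_self
      rcases List.append_eq_append_iff.1 hl with ⟨c, rfl, rfl⟩ | ⟨c, rfl, h⟩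
      · exact ⟨[], w, nil_mem_kstar _, rfl, append_mem_mul ha hl'⟩
      · rcases eq_or_ne c [] with rfl | hc
        · refine ⟨[], a, nil_mem_kstar _, by simp, ?_⟩
          rw [List.nil_append] at h
          rw [← h]
          exact append_mem_mul (a := []) (by simpa using ha) hl'
        · obtain ⟨u, v, hu, rfl, hy⟩ := ih hc h.symm fun x hx ↦ hmem x (List.mem_cons_of_mem _ hx)
          refine ⟨a ++ u, v, ?_, by simp, hy⟩
          rw [← one_add_self_mul_kstar_eq_kstar]
          exact Or.inr (append_mem_mul ha hu)
  · rintro ⟨u, v, hu, rfl, hy⟩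
    obtain ⟨a, ha, b, hb, rfl⟩ := mem_mul.1 hy
    have : v ++ a ++ b ∈ L∗ := by
      rw [← one_add_self_mul_kstar_eq_kstar]
      exact Or.inr (append_mem_mul ha hb)
    obtain ⟨l, rfl, hl⟩ := hu
    obtain ⟨m, hm, hm'⟩ := this
    refine ⟨l ++ m, by simp [← hm], fun z hz ↦ ?_⟩
    rcases List.mem_append.1 hz with h | h
    exacts [hl z h, hm' z h]

theorem IsRegular.kstar {L : Language α} (hL : L.IsRegular) : (L∗).IsRegular := by
  have hL := hL.finite_range_leftQuotient
  refine .of_finite_range_leftQuotient (((hL.powerset.image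
    fun q : Set (Language α) ↦ {y : List α | ∃ N ∈ q, y ∈ N * L∗}).insert L∗).subset ?_)
  rintro _ ⟨w, rfl⟩
  rcases eq_or_ne w [] with rfl | hw
  · exact Or.inl rfl
  refine Or.inr ⟨{N | ∃ u v, u ∈ L∗ ∧ u ++ v = w ∧ L.leftQuotient v = N}, ?_, ?_⟩
  · rintro _ ⟨u, v, -, -, rfl⟩
    exact ⟨v, rfl⟩
  · ext y
    change _ ↔ w ++ y ∈ L∗
    rw [append_mem_kstar_iff hw]
    constructor
    · rintro ⟨_, ⟨u, v, hu, huv, rfl⟩, hy⟩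
      exact ⟨u, v, hu, huv, hy⟩
    · rintro ⟨u, v, hu, huv, hy⟩
      exact ⟨_, ⟨u, v, hu, huv, rfl⟩, hy⟩

theorem mem_map_iff {f : α → β} {L : Language α} {w : List β} :
    w ∈ map f L ↔ ∃ u ∈ L, u.map f = w := Iff.rfl

theorem IsRegular.map {L : Language α} (hL : L.IsRegular) (f : α → β) :
    (Language.map f L).IsRegular := by
  have hL := hL.finite_range_leftQuotient
  refine .of_finite_range_leftQuotient ((hL.powerset.image
    fun q : Set (Language α) ↦ {y : List β | ∃ N ∈ q, y ∈ Language.map f N}).subset ?_)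
  rintro _ ⟨w, rfl⟩
  refine ⟨{N | ∃ u, u.map f = w ∧ L.leftQuotient u = N}, ?_, ?_⟩
  · rintro _ ⟨u, -, rfl⟩
    exact ⟨u, rfl⟩
  · ext y
    change _ ↔ w ++ y ∈ Language.map f L
    constructor
    · rintro ⟨_, ⟨u, rfl, rfl⟩, v, hv, rfl⟩
      exact ⟨u ++ v, hv, by simp⟩
    · rintro ⟨u, hu, h⟩
      obtain ⟨a, b, rfl, rfl, rfl⟩ := List.map_eq_append_iff.1 h
      exact ⟨_, ⟨a, rfl, rfl⟩, b, hu, rfl⟩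

theorem isRegular_singleton (x : List α) : ({x} : Language α).IsRegular := by
  refine .of_finite_range_leftQuotient
    (((List.finite_toSet x.tails).image (fun s ↦ ({s} : Language α)) |>.insert 0).subset ?_)
  rintro _ ⟨w, rfl⟩
  by_cases h : ∃ s, w ++ s = x
  · obtain ⟨s, rfl⟩ := h
    refine Or.inr ⟨s, by simp, ?_⟩
    ext y
    rw [mem_leftQuotient]
    change y = s ↔ w ++ y = w ++ s
    simp
  · refine Or.inl ?_
    ext y
    rw [mem_leftQuotient]
    exact ⟨fun hy ↦ (h ⟨y, hy⟩).elim, fun hy ↦ (notMem_zero _ hy).elim⟩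

theorem isRegular_zero : (0 : Language α).IsRegular := by
  refine .of_finite_range_leftQuotient ((Set.finite_singleton (0 : Language α)).subset ?_)
  rintro _ ⟨w, rfl⟩
  rfl

theorem isRegular_of_finite {L : Language α} (h : Set.Finite (L : Set (List α))) :
    L.IsRegular := by
  induction L, h using Set.Finite.induction_on with
  | empty => exact isRegular_zero
  | @insert a s _ _ ih => exact (isRegular_singleton a).add ih

theorem IsRegular.leftQuotient {L : Language α} (hL : L.IsRegular) (w : List α) :
    (L.leftQuotient w).IsRegular := by
  refine .of_finite_range_leftQuotient (hL.finite_range_leftQuotient.subset ?_)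
  rintro _ ⟨v, rfl⟩
  exact ⟨w ++ v, leftQuotient_append ..⟩

theorem isRegular_iSup {ι : Type} [Finite ι] {L : ι → Language α}
    (hL : ∀ i, (L i).IsRegular) : (⨆ i, L i).IsRegular := by
  classical
  have := Fintype.ofFinite ι
  have h (s : Finset ι) : (⨆ i ∈ s, L i).IsRegular := by
    induction s using Finset.induction_on with
    | empty =>
      simp only [Finset.notMem_empty, iSup_false, iSup_bot]
      exact isRegular_zero
    | insert i s _ ih =>
      rw [Finset.iSup_insert]
      exact (hL i).add ih
  simpa using h Finset.univ

theorem append_mem_kstar {L : Language α} {u v : List α} (hu : u ∈ L) (hv : v ∈ L∗) :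
    u ++ v ∈ L∗ := by
  rw [← one_add_self_mul_kstar_eq_kstar]
  exact Or.inr (append_mem_mul hu hv)

theorem isRegular_top (α : Type) : (⊤ : Language α).IsRegular :=
  ⟨Unit, inferInstance, ⟨fun _ _ ↦ (), (), Set.univ⟩, rfl⟩

theorem mem_map_top_iff {f : α → β} {w : List β} :
    w ∈ map f ⊤ ↔ ∃ l : List α, l.map f = w := by
  rw [mem_map_iff]
  exact ⟨fun ⟨l, _, hl⟩ ↦ ⟨l, hl⟩, fun ⟨l, hl⟩ ↦ ⟨l, trivial, hl⟩⟩

end Language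

/-! ### Nondeterministic stack programs -/

/-- An operation on one stack. -/
inductive StackOp (A : Type) : Type
  | nop
  | push (a : A)
  | pop (a : A)
  | empty

namespace StackOp

variable {A : Type}

/-- The condition under which an operation may be applied to a stack: `pop a` needs `a` on top, and
`empty` is a test for emptiness. -/
def Enabled : StackOp A → List A → Prop
  | nop, _ => True
  | push _, _ => True
  | pop a, s => s.head? = some a
  | empty, s => s.head? = none

/-- The effect of an operation on a stack (whose top is the head of the list). -/
def apply : StackOp A → List A → List A
  | nop, s => s
  | push a, s => a :: s
  | pop _, s => s.tail
  | empty, s => s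

/-- The sequence of operations can be performed on the stack `s`, and leads to `s'`. -/
def Runs : List (StackOp A) → List A → List A → Prop
  | [], s, s' => s = s'
  | o :: l, s, s' => o.Enabled s ∧ Runs l (o.apply s) s'

/-- The effect of a sequence of operations on a stack, whether they are enabled or not. -/
def applyAll (l : List (StackOp A)) (s : List A) : List A :=
  l.foldl (fun s o ↦ o.apply s) s

theorem Runs.applyAll_eq {l : List (StackOp A)} {s s' : List A} (h : Runs l s s') :
    applyAll l s = s' := by
  induction l generalizing s with
  | nil => exact h
  | cons o l ih => exact ih h.2

theorem length_apply_le (o : StackOp A) (s : List A) : (o.apply s).length ≤ s.length + 1 := by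
  cases o with
  | push a => exact le_rfl
  | pop a => simp only [apply, List.length_tail]; omega
  | _ => exact Nat.le_succ _

theorem length_applyAll_le (l : List (StackOp A)) (s : List A) :
    (applyAll l s).length ≤ s.length + l.length := by
  induction l generalizing s with
  | nil => simp [applyAll]
  | cons o l ih =>
    have h₁ := ih (o.apply s)
    have h₂ := o.length_apply_le s
    simp only [applyAll, List.foldl_cons, List.length_cons] at h₁ ⊢
    omega

variable {D : Type}

theorem runs_append {l m : List (StackOp A)} {s s' : List A} :
    Runs (l ++ m) s s' ↔ ∃ s₁, Runs l s s₁ ∧ Runs m s₁ s' := by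
  induction l generalizing s with
  | nil => simp [Runs]
  | cons o l ih => simp [Runs, ih, and_assoc]

theorem runs_singleton_nop {s s' : List A} : Runs [nop] s s' ↔ s = s' := and_iff_right trivial

theorem runs_singleton_pop {a : A} {s s' : List A} : Runs [pop a] s s' ↔ s = a :: s' := by
  cases s <;> simp [Runs, Enabled, apply]

theorem runs_map_nop {l : List D} {s s' : List A} :
    Runs (l.map fun _ ↦ nop) s s' ↔ s = s' := by
  induction l generalizing s with
  | nil => rfl
  | cons d l ih => exact (and_iff_right trivial).trans ih

theorem runs_map_pop {l : List D} {f : D → A} {s s' : List A} :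
    Runs (l.map fun d ↦ pop (f d)) s s' ↔ s = l.map f ++ s' := by
  induction l generalizing s with
  | nil => rfl
  | cons d l ih => cases s <;> simp [Runs, Enabled, apply, ih]

theorem runs_pop {l s s' : List A} : Runs (l.map pop) s s' ↔ s = l ++ s' := by
  have h := runs_map_pop (l := l) (f := id) (s := s) (s' := s')
  rwa [List.map_id] at h

theorem runs_map_push {l : List D} {f : D → A} {s s' : List A} :
    Runs (l.map fun d ↦ push (f d)) s s' ↔ s' = (l.map f).reverse ++ s := by
  induction l generalizing s with
  | nil => exact eq_comm
  | cons d l ih => simp [Runs, Enabled, apply, ih]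

theorem runs_push {l s s' : List A} : Runs (l.map push) s s' ↔ s' = l.reverse ++ s := by
  have h := runs_map_push (l := l) (f := id) (s := s) (s' := s')
  rwa [List.map_id] at h

/-- Pop the given symbol, if there is one. -/
def popOpt : Option A → StackOp A
  | none => nop
  | some a => pop a

/-- Push the given symbol, if there is one. -/
def pushOpt : Option A → StackOp A
  | none => nop
  | some a => push a

theorem runs_map_popOpt {l : List D} {f : D → Option A} {s s' : List A} :
    Runs (l.map fun d ↦ popOpt (f d)) s s' ↔ s = l.filterMap f ++ s' := by
  induction l generalizing s with
  | nil => rfl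
  | cons d l ih =>
    rw [List.map_cons, List.filterMap_cons]
    cases f d with
    | none => exact (and_iff_right trivial).trans ih
    | some a =>
      rw [popOpt, Runs, ih]
      cases s <;> simp [Enabled, apply]

theorem runs_map_pushOpt {l : List D} {f : D → Option A} {s s' : List A} :
    Runs (l.map fun d ↦ pushOpt (f d)) s s' ↔ s' = (l.filterMap f).reverse ++ s := by
  induction l generalizing s with
  | nil => exact eq_comm
  | cons d l ih =>
    rw [List.map_cons, List.filterMap_cons]
    cases f d with
    | none => exact (and_iff_right trivial).trans ih
    | some a =>
      rw [pushOpt, Runs, ih]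
      simp [Enabled, apply]

end StackOp

namespace StackMachine

open Turing StateTransition

/-- The stacks of the verifier: an input stack, an output stack and the work stacks. -/
inductive Tape (K : Type) : Type
  | input
  | output
  | work (k : K)
  deriving DecidableEq

instance {K : Type} [Finite K] : Finite (Tape K) :=
  Finite.of_injective
    (fun t : Tape K ↦ (match t with
      | .input => none
      | .output => some none
      | .work k => some (some k) : Option (Option K)))
    (by rintro (_ | _ | k) (_ | _ | k') h <;> simp_all)

/-- The alphabets of the stacks of the verifier. -/
def Tape.Alphabet (Γ Δ K : Type) : Tape K → Type
  | .input => Γ ⊕ Δ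
  | .output => Bool
  | .work _ => Γ

/-- The labels of the verifier: fetch an input symbol; store a symbol of the input word on a work
stack; execute the operations named by a symbol of the certificate; clear the work stacks; halt. -/
inductive Label (Γ Δ : Type) : Type
  | fetch
  | store (g : Γ)
  | exec (d : Δ)
  | clear
  | finish

instance {Γ Δ : Type} [Finite Γ] [Finite Δ] : Finite (Label Γ Δ) :=
  Finite.of_injective
    (fun t : Label Γ Δ ↦ (match t with
      | .fetch => .inl 0
      | .clear => .inl 1
      | .finish => .inl 2
      | .store g => .inr (.inl g)
      | .exec d => .inr (.inr d) : Fin 3 ⊕ Γ ⊕ Δ))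
    (by rintro (_ | _ | _ | _ | _) (_ | _ | _ | _ | _) h <;> simp_all)

/-- The finite memory of the verifier: the last input symbol, the state of the automaton that reads
the certificate, whether all tests have succeeded, and whether clearing the stacks goes on. -/
structure Control (Γ Δ Q : Type) : Type where
  symbol : Option (Γ ⊕ Δ)
  state : Q
  ok : Bool
  busy : Bool

instance {Γ Δ Q : Type} [Finite Γ] [Finite Δ] [Finite Q] : Finite (Control Γ Δ Q) :=
  Finite.of_injective (fun v : Control Γ Δ Q ↦ (v.symbol, v.state, v.ok, v.busy))
    (by rintro ⟨⟩ ⟨⟩ h; simp_all)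

open Classical in
/-- Record the outcome of a test. -/
noncomputable def Control.check {Γ Δ Q : Type} (v : Control Γ Δ Q) (p : Prop) : Control Γ Δ Q :=
  { v with ok := v.ok && decide p }

variable {Γ Δ K Q : Type}

/-- The contents of all stacks. -/
def contents (i : List (Γ ⊕ Δ)) (o : List Bool) (W : K → List Γ) :
    ∀ t : Tape K, List (t.Alphabet Γ Δ K)
  | .input => i
  | .output => o
  | .work k => W k

variable [DecidableEq K]

theorem update_contents_input (i i' : List (Γ ⊕ Δ)) (o : List Bool) (W : K → List Γ) :
    Function.update (contents i o W) .input i' = contents i' o W := by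
  funext t
  rcases t with _ | _ | k
  · exact Function.update_self ..
  all_goals exact Function.update_of_ne (by simp) ..

theorem update_contents_output (i : List (Γ ⊕ Δ)) (o o' : List Bool) (W : K → List Γ) :
    Function.update (contents i o W) .output o' = contents i o' W := by
  funext t
  rcases t with _ | _ | k
  · exact Function.update_of_ne (by simp) ..
  · exact Function.update_self ..
  · exact Function.update_of_ne (by simp) ..

theorem update_contents_work (i : List (Γ ⊕ Δ)) (o : List Bool) (W : K → List Γ) (k : K)
    (s : List Γ) :
    Function.update (contents i o W) (.work k) s = contents i o (Function.update W k s) := by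
  funext t
  rcases t with _ | _ | k'
  · exact Function.update_of_ne (by simp) ..
  · exact Function.update_of_ne (by simp) ..
  · by_cases h : k' = k
    · subst h
      exact (Function.update_self ..).trans (Function.update_self k' s W).symm
    · exact (Function.update_of_ne (by simpa using h) ..).trans
        (show W k' = Function.update W k s k' from (Function.update_of_ne h s W).symm)

/-- The statements of the verifier. -/
abbrev VStmt (Γ Δ K Q : Type) : Type :=
  TM2.Stmt (Tape.Alphabet Γ Δ K) (Label Γ Δ) (Control Γ Δ Q)

theorem stepAux_push_work (k : K) (f : Control Γ Δ Q → Γ) (q : VStmt Γ Δ K Q)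
    (v : Control Γ Δ Q) (i : List (Γ ⊕ Δ)) (o : List Bool) (W : K → List Γ) :
    TM2.stepAux (.push (.work k) f q) v (contents i o W) =
      TM2.stepAux q v (contents i o (Function.update W k (f v :: W k))) :=
  congrArg (TM2.stepAux q v) (update_contents_work i o W k (f v :: W k))

theorem stepAux_pop_work (k : K) (f : Control Γ Δ Q → Option Γ → Control Γ Δ Q)
    (q : VStmt Γ Δ K Q) (v : Control Γ Δ Q) (i : List (Γ ⊕ Δ)) (o : List Bool) (W : K → List Γ) :
    TM2.stepAux (.pop (.work k) f q) v (contents i o W) =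
      TM2.stepAux q (f v (W k).head?) (contents i o (Function.update W k (W k).tail)) :=
  congrArg (TM2.stepAux q (f v (W k).head?)) (update_contents_work i o W k (W k).tail)

theorem stepAux_peek_work (k : K) (f : Control Γ Δ Q → Option Γ → Control Γ Δ Q)
    (q : VStmt Γ Δ K Q) (v : Control Γ Δ Q) (i : List (Γ ⊕ Δ)) (o : List Bool) (W : K → List Γ) :
    TM2.stepAux (.peek (.work k) f q) v (contents i o W) =
      TM2.stepAux q (f v (W k).head?) (contents i o W) := rfl

theorem stepAux_pop_input (f : Control Γ Δ Q → Option (Γ ⊕ Δ) → Control Γ Δ Q)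
    (q : VStmt Γ Δ K Q) (v : Control Γ Δ Q) (i : List (Γ ⊕ Δ)) (o : List Bool) (W : K → List Γ) :
    TM2.stepAux (.pop .input f q) v (contents i o W) =
      TM2.stepAux q (f v i.head?) (contents i.tail o W) :=
  congrArg (TM2.stepAux q (f v i.head?)) (update_contents_input i i.tail o W)

theorem stepAux_push_output (f : Control Γ Δ Q → Bool) (q : VStmt Γ Δ K Q)
    (v : Control Γ Δ Q) (i : List (Γ ⊕ Δ)) (o : List Bool) (W : K → List Γ) :
    TM2.stepAux (.push .output f q) v (contents i o W) =
      TM2.stepAux q v (contents i (f v :: o) W) :=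
  congrArg (TM2.stepAux q v) (update_contents_output i o (f v :: o) W)

/-- The statement that performs one operation on one work stack. -/
noncomputable def opStmt (k : K) : StackOp Γ → VStmt Γ Δ K Q → VStmt Γ Δ K Q
  | .nop, q => q
  | .push a, q => .push (.work k) (fun _ ↦ a) q
  | .pop a, q => .pop (.work k) (fun v (t : Option Γ) ↦ v.check (t = some a)) q
  | .empty, q => .peek (.work k) (fun v (t : Option Γ) ↦ v.check (t = none)) q

theorem stepAux_opStmt (k : K) (o : StackOp Γ) (q : VStmt Γ Δ K Q) (v : Control Γ Δ Q)
    (i : List (Γ ⊕ Δ)) (out : List Bool) (W : K → List Γ) :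
    TM2.stepAux (opStmt k o q) v (contents i out W) =
      TM2.stepAux q (v.check (o.Enabled (W k)))
        (contents i out (Function.update W k (o.apply (W k)))) := by
  cases o with
  | nop =>
    have h : v.check True = v := by simp [Control.check]
    simp [opStmt, StackOp.Enabled, StackOp.apply, h]
  | push a =>
    have h : v.check True = v := by simp [Control.check]
    simp only [opStmt, StackOp.Enabled, h]
    exact stepAux_push_work ..
  | pop a => exact stepAux_pop_work ..
  | empty =>
    rw [StackOp.apply, Function.update_eq_self]
    exact stepAux_peek_work ..

theorem Control.check_check (v : Control Γ Δ Q) (p q : Prop) :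
    (v.check p).check q = v.check (p ∧ q) := by
  refine congrArg (fun b ↦ Control.mk v.symbol v.state b v.busy) ?_
  rw [Bool.eq_iff_iff]
  simp [and_assoc, Control.check]

theorem stepAux_foldr_opStmt (f : K → StackOp Γ) (ks : List K) (hks : ks.Nodup)
    (q : VStmt Γ Δ K Q) (v : Control Γ Δ Q) (i : List (Γ ⊕ Δ)) (out : List Bool)
    (W : K → List Γ) :
    TM2.stepAux (ks.foldr (fun k ↦ opStmt k (f k)) q) v (contents i out W) =
      TM2.stepAux q (v.check (∀ k ∈ ks, (f k).Enabled (W k)))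
        (contents i out fun k ↦ if k ∈ ks then (f k).apply (W k) else W k) := by
  induction ks generalizing v W with
  | nil => simp [Control.check]
  | cons k ks ih =>
    obtain ⟨hk, hks⟩ := List.nodup_cons.1 hks
    rw [List.foldr_cons, stepAux_opStmt, ih hks, Control.check_check]
    have hne : ∀ k' ∈ ks, k' ≠ k := fun k' hk' h ↦ hk (h ▸ hk')
    congr 2
    · have : (∀ k' ∈ ks, (f k').Enabled (Function.update W k ((f k).apply (W k)) k')) ↔
          ∀ k' ∈ ks, (f k').Enabled (W k') :=
        forall₂_congr fun k' hk' ↦ by rw [Function.update_of_ne (hne k' hk')]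
      rw [this, List.forall_mem_cons]
    · funext k'
      by_cases h : k' = k
      · subst h
        simp [hk]
      · simp [h]

/-- The statement that removes the top element of each work stack, and notes whether there was
one. -/
def clearStmt (ks : List K) (q : VStmt Γ Δ K Q) : VStmt Γ Δ K Q :=
  ks.foldr (fun k ↦ .pop (.work k) fun v t ↦
    { v with ok := v.ok && t.isNone, busy := v.busy || t.isSome }) q

theorem stepAux_clearStmt (ks : List K) (hks : ks.Nodup) (q : VStmt Γ Δ K Q)
    (v : Control Γ Δ Q) (i : List (Γ ⊕ Δ)) (out : List Bool) (W : K → List Γ) :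
    TM2.stepAux (clearStmt ks q) v (contents i out W) =
      TM2.stepAux q
        { v with
          ok := v.ok && ks.all fun k ↦ (W k).isEmpty
          busy := v.busy || !ks.all fun k ↦ (W k).isEmpty }
        (contents i out fun k ↦ if k ∈ ks then (W k).tail else W k) := by
  induction ks generalizing v W with
  | nil => simp [clearStmt]
  | cons k ks ih =>
    obtain ⟨hk, hks⟩ := List.nodup_cons.1 hks
    have hne : ∀ k' ∈ ks, k' ≠ k := fun k' hk' h ↦ hk (h ▸ hk')
    rw [clearStmt, List.foldr_cons, ← clearStmt]
    refine (stepAux_pop_work k (fun v t ↦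
      { v with ok := v.ok && t.isNone, busy := v.busy || t.isSome }) _ v i out W).trans ?_
    rw [ih hks]
    have hall : (ks.all fun k' ↦ (Function.update W k (W k).tail k').isEmpty) =
        ks.all fun k' ↦ (W k').isEmpty := by
      rw [Bool.eq_iff_iff, List.all_eq_true, List.all_eq_true]
      exact forall₂_congr fun k' hk' ↦ by rw [Function.update_of_ne (hne k' hk')]
    congr 1
    · simp only [hall, List.all_cons]
      cases W k <;> simp
    · congr 1
      funext k'
      by_cases h : k' = k
      · subst h
        simp only [hk, if_false, List.mem_cons_self, if_true, Function.update_self]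
      · simp [h]

variable (k₀ : K) (op : Δ → K → StackOp Γ) (M : DFA Δ Q)

open Classical in
/-- The program of the verifier. It stores the input word on the work stack `k₀`, then performs the
operations named by the certificate, and accepts if the automaton `M` accepts the certificate, all
operations are enabled and all work stacks end up empty. -/
noncomputable def program [Fintype K] : Label Γ Δ → VStmt Γ Δ K Q
  | .fetch => .pop .input (fun v t ↦ { v with symbol := t }) <| .goto fun v ↦
      match v.symbol with
      | none => .clear
      | some (.inl g) => .store g
      | some (.inr d) => .exec d
  | .store g => .push (.work k₀) (fun _ ↦ g) <| .goto fun _ ↦ .fetch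
  | .exec d => Finset.univ.toList.foldr (fun k ↦ opStmt k (op d k)) <|
      .load (fun v ↦ { v with state := M.step v.state d }) <| .goto fun _ ↦ .fetch
  | .clear => .load (fun v ↦ { v with busy := false }) <|
      clearStmt Finset.univ.toList <| .goto fun v ↦ if v.busy then .clear else .finish
  | .finish => .push .output (fun v ↦ v.ok && decide (v.state ∈ M.accept)) <|
      .load (fun _ ↦ ⟨none, M.start, true, false⟩) .halt

/-- The verifier as a bundled machine. -/
noncomputable def machine [Finite Γ] [Finite Δ] [Fintype K] [Finite Q] : FinTM2 where
  K := Tape K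
  kFin := Fintype.ofFinite _
  k₀ := .input
  k₁ := .output
  Γ := Tape.Alphabet Γ Δ K
  Λ := Label Γ Δ
  main := .fetch
  ΛFin := Fintype.ofFinite _
  σ := Control Γ Δ Q
  initialState := ⟨none, M.start, true, false⟩
  σFin := Fintype.ofFinite _
  Γk₀Fin := (Fintype.ofFinite (Γ ⊕ Δ) : )
  m := program k₀ op M

/-- The configurations of the verifier. -/
abbrev VCfg (Γ Δ K Q : Type) : Type :=
  TM2.Cfg (Tape.Alphabet Γ Δ K) (Label Γ Δ) (Control Γ Δ Q)

section Execution

variable [Fintype K]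

/-- The verifier gets from `a` to `b` in `n` steps. -/
def ReachesIn (n : ℕ) (a b : VCfg Γ Δ K Q) : Prop :=
  (flip bind (TM2.step (program k₀ op M)))^[n] (some a) = some b

variable {k₀ op M}

theorem ReachesIn.trans {m n : ℕ} {a b c : VCfg Γ Δ K Q} (h₁ : ReachesIn k₀ op M m a b)
    (h₂ : ReachesIn k₀ op M n b c) : ReachesIn k₀ op M (n + m) a c := by
  rw [ReachesIn, Function.iterate_add_apply, h₁, h₂]

theorem ReachesIn.single {a b : VCfg Γ Δ K Q} (h : TM2.step (program k₀ op M) a = some b) :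
    ReachesIn k₀ op M 1 a b := h

theorem step_fetch (v : Control Γ Δ Q) (i : List (Γ ⊕ Δ)) (o : List Bool) (W : K → List Γ) :
    TM2.step (program k₀ op M) ⟨some .fetch, v, contents i o W⟩ =
      some ⟨some (match i.head? with
        | none => .clear
        | some (.inl g) => .store g
        | some (.inr d) => .exec d), { v with symbol := i.head? }, contents i.tail o W⟩ :=
  congrArg some (stepAux_pop_input (fun v t ↦ { v with symbol := t }) _ v i o W)

theorem reachesIn_store (x : List Γ) (v : Control Γ Δ Q) (i : List (Γ ⊕ Δ)) (o : List Bool)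
    (W : K → List Γ) :
    ∃ s, ReachesIn k₀ op M (2 * x.length)
      ⟨some .fetch, v, contents (x.map .inl ++ i) o W⟩
      ⟨some .fetch, { v with symbol := s },
        contents i o (Function.update W k₀ (x.reverse ++ W k₀))⟩ := by
  induction x generalizing v W with
  | nil => exact ⟨v.symbol, by simp [ReachesIn]⟩
  | cons g x ih =>
    obtain ⟨s, hs⟩ := ih { v with symbol := some (.inl g) } (Function.update W k₀ (g :: W k₀))
    have h₁ : ReachesIn k₀ op M 1 ⟨some .fetch, v, contents ((g :: x).map .inl ++ i) o W⟩
        ⟨some (.store g), { v with symbol := some (.inl g) }, contents (x.map .inl ++ i) o W⟩ :=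
      .single (step_fetch ..)
    have h₂ : ReachesIn k₀ op M 1
        ⟨some (.store g), { v with symbol := some (.inl g) }, contents (x.map .inl ++ i) o W⟩
        ⟨some .fetch, { v with symbol := some (.inl g) },
          contents (x.map .inl ++ i) o (Function.update W k₀ (g :: W k₀))⟩ := by
      refine .single (congrArg some ?_)
      rw [program, stepAux_push_work]
      rfl
    refine ⟨s, ?_⟩
    have := (h₁.trans h₂).trans hs
    simpa [Nat.mul_add] using this

theorem reachesIn_exec (c : List Δ) (v : Control Γ Δ Q) (o : List Bool) (W : K → List Γ) :
    ∃ v' : Control Γ Δ Q, ReachesIn k₀ op M (2 * c.length)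
        ⟨some .fetch, v, contents (c.map .inr) o W⟩
        ⟨some .fetch, v', contents [] o fun k ↦ StackOp.applyAll (c.map (op · k)) (W k)⟩ ∧
      v'.state = M.evalFrom v.state c ∧
      (v'.ok = true ↔ v.ok = true ∧ ∀ k, StackOp.Runs (c.map (op · k)) (W k)
        (StackOp.applyAll (c.map (op · k)) (W k))) := by
  induction c generalizing v W with
  | nil => exact ⟨v, by simp [ReachesIn, StackOp.applyAll], rfl,
      by simp [StackOp.Runs, StackOp.applyAll]⟩
  | cons d c ih =>
    let v₁ : Control Γ Δ Q := { v with symbol := some (.inr d) }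
    let v₂ : Control Γ Δ Q := v₁.check (∀ k, (op d k).Enabled (W k))
    let v₃ : Control Γ Δ Q := { v₂ with state := M.step v₂.state d }
    obtain ⟨v', h, hstate, hok⟩ := ih v₃ fun k ↦ (op d k).apply (W k)
    have h₁ : ReachesIn k₀ op M 1 ⟨some .fetch, v, contents ((d :: c).map .inr) o W⟩
        ⟨some (.exec d), v₁, contents (c.map .inr) o W⟩ :=
      .single (step_fetch ..)
    have h₂ : ReachesIn k₀ op M 1 ⟨some (.exec d), v₁, contents (c.map .inr) o W⟩
        ⟨some .fetch, v₃, contents (c.map .inr) o fun k ↦ (op d k).apply (W k)⟩ := by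
      refine .single (congrArg some ?_)
      rw [program, stepAux_foldr_opStmt _ _ (Finset.nodup_toList _)]
      simp only [Finset.mem_toList, Finset.mem_univ, forall_true_left, if_true]
      rfl
    refine ⟨v', ?_, hstate, ?_⟩
    · have := (h₁.trans h₂).trans h
      rw [List.length_cons, Nat.mul_add]
      exact this
    · rw [hok]
      simp only [v₃, v₂, v₁, Control.check, Bool.and_eq_true, decide_eq_true_eq, and_assoc,
        ← forall_and]
      rfl

theorem reachesIn_clear (n : ℕ) (v : Control Γ Δ Q) (i : List (Γ ⊕ Δ)) (o : List Bool)
    (W : K → List Γ) (hW : ∀ k, (W k).length ≤ n) :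
    ∃ m ≤ n + 1, ∃ v' : Control Γ Δ Q, ReachesIn k₀ op M m ⟨some .clear, v, contents i o W⟩
        ⟨some .finish, v', contents i o fun _ ↦ []⟩ ∧
      v'.state = v.state ∧ (v'.ok = true ↔ v.ok = true ∧ ∀ k, W k = []) := by
  have hstep (v : Control Γ Δ Q) (W : K → List Γ) :
      TM2.step (program k₀ op M) ⟨some .clear, v, contents i o W⟩ =
        some ⟨if ∀ k, W k = [] then some .finish else some .clear,
          { v with ok := v.ok && decide (∀ k, W k = []), busy := !decide (∀ k, W k = []) },
          contents i o fun k ↦ (W k).tail⟩ := by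
    refine congrArg some ?_
    have hall : (Finset.univ.toList.all fun k ↦ (W k).isEmpty) = decide (∀ k, W k = []) := by
      rw [Bool.eq_iff_iff]
      simp
    rw [program, TM2.stepAux, stepAux_clearStmt _ (Finset.nodup_toList _), hall]
    simp only [Finset.mem_toList, Finset.mem_univ, if_true, TM2.stepAux, Bool.false_or]
    by_cases h : ∀ k, W k = [] <;> simp [h]
  induction n generalizing v W with
  | zero =>
    have h : ∀ k, W k = [] := fun k ↦ List.eq_nil_of_length_eq_zero (Nat.le_zero.1 (hW k))
    refine ⟨1, le_rfl,
      { v with ok := v.ok && decide (∀ k, W k = []), busy := !decide (∀ k, W k = []) },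
      .single ((hstep v W).trans ?_), rfl, ?_⟩
    · simp [h]
    · simp [h]
  | succ n ih =>
    by_cases h : ∀ k, W k = []
    · refine ⟨1, by omega,
        { v with ok := v.ok && decide (∀ k, W k = []), busy := !decide (∀ k, W k = []) },
        .single ((hstep v W).trans ?_), rfl, ?_⟩
      · simp [h]
      · simp [h]
    · obtain ⟨m, hm, v', hr, hs, hok⟩ := ih
        { v with ok := v.ok && decide (∀ k, W k = []), busy := !decide (∀ k, W k = []) }
        (fun k ↦ (W k).tail) fun k ↦ by have := hW k; rw [List.length_tail]; omega
      refine ⟨m + 1, by omega, v', ReachesIn.trans (.single ((hstep v W).trans ?_)) hr, hs, ?_⟩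
      · simp [h]
      · rw [hok]
        simp [h]

open Classical in
theorem reachesIn_halt (x : List Γ) (c : List Δ) :
    ∃ n ≤ 3 * (x.length + c.length) + 3, ReachesIn k₀ op M n
      ⟨some .fetch, ⟨none, M.start, true, false⟩,
        contents (x.map .inl ++ c.map .inr) [] fun _ ↦ []⟩
      ⟨none, ⟨none, M.start, true, false⟩,
        contents [] [decide (c ∈ M.accepts ∧ ∀ k, StackOp.Runs (c.map (op · k))
          (if k = k₀ then x.reverse else []) [])] fun _ ↦ []⟩ := by
  obtain ⟨s, h₁⟩ := reachesIn_store (k₀ := k₀) (op := op) (M := M) x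
    ⟨none, M.start, true, false⟩ (c.map .inr) [] fun _ ↦ []
  have hW : Function.update (fun _ ↦ []) k₀ (x.reverse ++ []) =
      fun k ↦ if k = k₀ then x.reverse else [] := by
    funext k
    by_cases h : k = k₀
    · subst h
      simp
    · simp [h]
  rw [hW] at h₁
  obtain ⟨v, h₂, hstate, hok⟩ := reachesIn_exec (k₀ := k₀) (op := op) (M := M) c
    ⟨s, M.start, true, false⟩ [] fun k ↦ if k = k₀ then x.reverse else []
  have h₃ : ReachesIn k₀ op M 1 _ _ := .single (step_fetch (k₀ := k₀) (op := op) (M := M) v [] []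
    fun k ↦ StackOp.applyAll (c.map (op · k)) (if k = k₀ then x.reverse else []))
  obtain ⟨m, hm, v', h₄, hstate', hok'⟩ := reachesIn_clear (k₀ := k₀) (op := op) (M := M)
    (x.length + c.length) { v with symbol := none } [] []
    (fun k ↦ StackOp.applyAll (c.map (op · k)) (if k = k₀ then x.reverse else [])) fun k ↦ by
      refine (StackOp.length_applyAll_le _ _).trans ?_
      rw [List.length_map]
      split <;> simp
  have h₅ : ReachesIn k₀ op M 1 ⟨some .finish, v', contents [] [] fun _ ↦ []⟩
      ⟨none, ⟨none, M.start, true, false⟩,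
        contents [] [v'.ok && decide (v'.state ∈ M.accept)] fun _ ↦ []⟩ := by
    refine .single (congrArg some ?_)
    rw [program, stepAux_push_output]
    rfl
  have hb : (v'.ok && decide (v'.state ∈ M.accept)) = decide (c ∈ M.accepts ∧
      ∀ k, StackOp.Runs (c.map (op · k)) (if k = k₀ then x.reverse else []) []) := by
    rw [Bool.eq_iff_iff, decide_eq_true_eq, Bool.and_eq_true, decide_eq_true_eq, hok', hok,
      hstate', hstate, and_comm]
    refine and_congr Iff.rfl ⟨?_, ?_⟩
    · rintro ⟨⟨-, h⟩, h'⟩ k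
      have := h k
      rwa [h' k] at this
    · intro h
      exact ⟨⟨rfl, fun k ↦ by rw [(h k).applyAll_eq]; exact h k⟩, fun k ↦ (h k).applyAll_eq⟩
  rw [hb] at h₅
  exact ⟨_, by omega, (((h₁.trans h₂).trans h₃).trans h₄).trans h₅⟩

end Execution

variable [Finite Γ] [Finite Δ] [Fintype K] [Finite Q]

theorem initList_machine (i : List (Γ ⊕ Δ)) :
    initList (machine k₀ op M) i =
      ⟨some .fetch, ⟨none, M.start, true, false⟩, contents i [] fun _ ↦ []⟩ := by
  refine congrArg (TM2.Cfg.mk _ _) (funext fun t ↦ ?_)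
  rcases t with _ | _ | k <;> rfl

theorem haltList_machine (o : List Bool) :
    haltList (machine k₀ op M) o =
      ⟨none, ⟨none, M.start, true, false⟩, contents [] o fun _ ↦ []⟩ := by
  refine congrArg (TM2.Cfg.mk _ _) (funext fun t ↦ ?_)
  rcases t with _ | _ | k <;> rfl

end StackMachine

open Turing in
/-- A language is in NP if its words `x` are those for which some word of polynomial length over a
finite instruction set belongs to a regular language `R` and can be executed on finitely many
stacks, one of which initially contains `x` (with the last letter on top) while the others are
empty, in such a way that all stacks are empty in the end. -/
theorem mem_NP_of_runs {Γ Δ K : Type} [Finite Γ] [Finite Δ] [Finite K] [DecidableEq K] (k₀ : K)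
    (op : Δ → K → StackOp Γ) {R : Language Δ} (hR : R.IsRegular) (p : Polynomial ℕ)
    {L : Language Γ} (hL : ∀ x, x ∈ L ↔ ∃ c ∈ R, c.length ≤ p.eval x.length ∧
      ∀ k, StackOp.Runs (c.map (op · k)) (if k = k₀ then x.reverse else []) []) :
    L ∈ NP Γ := by
  classical
  obtain ⟨Q, _, M, rfl⟩ := hR
  have := Fintype.ofFinite K
  refine ⟨Δ, inferInstance, fun q ↦ decide (q.2 ∈ M.accepts ∧
    ∀ k, StackOp.Runs (q.2.map (op · k)) (if k = k₀ then q.1.reverse else []) []), p, ⟨?_⟩, ?_⟩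
  · refine ⟨⟨StackMachine.machine k₀ op M, Equiv.refl _, Equiv.refl _⟩, 3 * .X + 3, ?_⟩
    rintro ⟨x, c⟩
    have h := StackMachine.reachesIn_halt (k₀ := k₀) (op := op) (M := M) x c
    refine ⟨⟨h.choose, ?_⟩, h.choose_spec.1.trans (le_of_eq ?_)⟩
    · have h₁ : (flip bind (StackMachine.machine k₀ op M).step)^[h.choose]
          (some (initList (StackMachine.machine k₀ op M) (x.map Sum.inl ++ c.map Sum.inr))) =
          some (haltList (StackMachine.machine k₀ op M) [decide (c ∈ M.accepts ∧
            ∀ k, StackOp.Runs (c.map (op · k)) (if k = k₀ then x.reverse else []) [])]) := by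
        exact (congrArg (fun a ↦ (flip bind (StackMachine.machine k₀ op M).step)^[h.choose] (some a))
          (StackMachine.initList_machine k₀ op M _)).trans
          (Eq.trans h.choose_spec.2 (congrArg some (StackMachine.haltList_machine k₀ op M _).symm))
      exact (congrArg (fun i ↦ (flip bind (StackMachine.machine k₀ op M).step)^[h.choose]
        (some (initList (StackMachine.machine k₀ op M) i))) (List.map_id _)).trans h₁
    · simp [verifierInput]
  · intro x
    rw [hL x]
    simp only [decide_eq_true_eq]
    exact ⟨fun ⟨c, h₁, h₂, h₃⟩ ↦ ⟨c, h₂, h₁, h₃⟩, fun ⟨c, h₂, h₁, h₃⟩ ↦ ⟨c, h₁, h₂, h₃⟩⟩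

/-! ### Short solutions -/

namespace WordEq

open Relation

section Blocks

variable {ι C : Type}

/-- The positions of a concatenation of blocks `i` of lengths `n i`: the pairs of a block and an
offset in it. -/
def positions (n : ι → ℕ) (a : List ι) : List (ι × ℕ) :=
  a.flatMap fun i ↦ (List.range (n i)).map (Prod.mk i)

theorem mem_positions {n : ι → ℕ} {a : List ι} {s : ι × ℕ} :
    s ∈ positions n a ↔ s.1 ∈ a ∧ s.2 < n s.1 := by
  obtain ⟨i, o⟩ := s
  simp only [positions, List.mem_flatMap, List.mem_map, List.mem_range, Prod.mk.injEq]
  constructor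
  · rintro ⟨j, hj, o, ho, rfl, rfl⟩
    exact ⟨hj, ho⟩
  · rintro ⟨hi, ho⟩
    exact ⟨i, hi, o, ho, rfl, rfl⟩

theorem nodup_positions (n : ι → ℕ) {a : List ι} (ha : a.Nodup) : (positions n a).Nodup := by
  refine List.nodup_flatMap.2 ⟨fun i _ ↦ List.nodup_range.map fun o o' h ↦ (Prod.mk.inj h).2, ?_⟩
  refine ha.imp fun {i j} hij s hs ht ↦ hij ?_
  obtain ⟨o, -, rfl⟩ := List.mem_map.1 hs
  obtain ⟨o', -, h⟩ := List.mem_map.1 ht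
  exact (Prod.mk.inj h).1.symm

theorem length_positions (g : ι → List C) (a : List ι) :
    (positions (fun i ↦ (g i).length) a).length = (a.flatMap g).length := by
  simp [positions, List.length_flatMap]

theorem map_range_getElem? (l : List C) :
    (List.range l.length).map (fun o ↦ l[o]?) = l.map some := by
  refine List.ext_getElem (by simp) fun o h₁ h₂ ↦ ?_
  simp at h₁
  simp [h₁]

/-- The letter at a position. -/
def letterAt (g : ι → List C) (s : ι × ℕ) : Option C := (g s.1)[s.2]?

theorem map_letterAt_positions (g : ι → List C) (a : List ι) :
    (positions (fun i ↦ (g i).length) a).map (letterAt g) = (a.flatMap g).map some := by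
  simp only [positions, List.map_flatMap, List.map_map]
  exact List.flatMap_congr fun i _ ↦ map_range_getElem? (g i)

variable [DecidableEq ι]

theorem idxOf_positions {g : ι → List C} {a₁ a₂ : List ι} {i : ι} {o : ℕ} (hi : i ∉ a₁)
    (ho : o < (g i).length) :
    (positions (fun i ↦ (g i).length) (a₁ ++ i :: a₂)).idxOf (i, o) =
      (a₁.flatMap g).length + o := by
  have h₁ : (i, o) ∉ positions (fun i ↦ (g i).length) a₁ := fun h ↦ hi (mem_positions.1 h).1
  have h₂ : (i, o) ∈ (List.range (g i).length).map (Prod.mk i) :=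
    List.mem_map.2 ⟨o, List.mem_range.2 ho, rfl⟩
  have h₃ : ((List.range (g i).length).map (Prod.mk i)).idxOf (i, o) = o := by
    have hn : ((List.range (g i).length).map (Prod.mk i)).Nodup :=
      List.nodup_range.map fun o o' h ↦ (Prod.mk.inj h).2
    have := hn.idxOf_getElem o (by simpa using ho)
    simpa using this
  have h₄ : positions (fun i ↦ (g i).length) (a₁ ++ i :: a₂) =
      positions (fun i ↦ (g i).length) a₁ ++ ((List.range (g i).length).map (Prod.mk i) ++
        positions (fun i ↦ (g i).length) a₂) := by
    simp [positions]
  rw [h₄, List.idxOf_append_of_notMem h₁, List.idxOf_append_of_mem h₂, h₃, length_positions,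
    add_comm]

/-- If two occurrences of a block overlap or touch, then the block can be shortened: a prefix as
long as the distance of the two occurrences is removed, or all of it if the occurrences coincide. -/
theorem exists_shorter_block {g : ι → List C} {a₁ a₂ b₁ b₂ : List ι} {i : ι}
    (ha₁ : i ∉ a₁) (ha₂ : i ∉ a₂) (hb₁ : i ∉ b₁) (hb₂ : i ∉ b₂)
    (h : (a₁ ++ i :: a₂).flatMap g = (b₁ ++ i :: b₂).flatMap g) (hi : 0 < (g i).length)
    (hle : (a₁.flatMap g).length ≤ (b₁.flatMap g).length)
    (hd : (b₁.flatMap g).length ≤ (a₁.flatMap g).length + (g i).length) :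
    ∃ u : List C, u.length < (g i).length ∧
      (a₁ ++ i :: a₂).flatMap (Function.update g i u) =
        (b₁ ++ i :: b₂).flatMap (Function.update g i u) := by
  have hupd (u : List C) (l : List ι) (hl : i ∉ l) :
      l.flatMap (Function.update g i u) = l.flatMap g :=
    List.flatMap_congr fun j hj ↦ Function.update_of_ne (ne_of_mem_of_not_mem hj hl) _ _
  suffices ∃ u : List C, u.length < (g i).length ∧
      a₁.flatMap g ++ (u ++ a₂.flatMap g) = b₁.flatMap g ++ (u ++ b₂.flatMap g) by
    obtain ⟨u, hu, h⟩ := this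
    exact ⟨u, hu, by simpa [hupd, ha₁, ha₂, hb₁, hb₂] using h⟩
  simp only [List.flatMap_append, List.flatMap_cons] at h
  generalize a₁.flatMap g = p at *
  generalize a₂.flatMap g = q at *
  generalize b₁.flatMap g = p' at *
  generalize b₂.flatMap g = q' at *
  rcases hle.eq_or_lt with heq | hlt
  · obtain ⟨rfl, h⟩ := List.append_inj h heq
    exact ⟨[], hi, by simpa using h⟩
  · obtain ⟨v, rfl, hv⟩ : ∃ v, p' = p ++ v ∧ g i ++ q = v ++ (g i ++ q') := by
      rcases List.append_eq_append_iff.1 h with ⟨v, rfl, hv⟩ | ⟨v, rfl, hv⟩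
      · exact ⟨v, rfl, hv⟩
      · simp only [List.length_append] at hlt
        omega
    simp only [List.length_append] at hd hlt
    obtain ⟨u, hu, hu'⟩ : ∃ u, g i = v ++ u ∧ u ++ q = g i ++ q' := by
      rcases List.append_eq_append_iff.1 hv with ⟨u, rfl, hu⟩ | ⟨u, hu, hu'⟩
      · have : u = [] := List.eq_nil_of_length_eq_zero (by simp only [List.length_append] at hd; omega)
        subst this
        exact ⟨[], by simp, by simpa [eq_comm] using hu⟩
      · exact ⟨u, hu, hu'.symm⟩
    refine ⟨u, by rw [hu, List.length_append]; omega, ?_⟩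
    rw [hu', hu]
    simp

/-- The position `s` on the left side `a` and the position `t` on the right side `b` have the same
distance from the beginning. -/
def Linked (n : ι → ℕ) (a b : List ι) (s t : ι × ℕ) : Prop :=
  s ∈ positions n a ∧ t ∈ positions n b ∧ (positions n a).idxOf s = (positions n b).idxOf t

theorem Linked.rightUnique (n : ι → ℕ) (a b : List ι) : Relator.RightUnique (Linked n a b) :=
  fun _ _ _ h₁ h₂ ↦ (List.idxOf_inj h₁.2.1).1 (h₁.2.2.symm.trans h₂.2.2)

theorem Linked.leftUnique (n : ι → ℕ) (a b : List ι) : Relator.LeftUnique (Linked n a b) :=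
  fun _ _ _ h₁ h₂ ↦ (List.idxOf_inj h₁.1).1 (h₁.2.2.trans h₂.2.2.symm)

theorem reflTransGen_or_of_eqvGen {α : Type} {r : α → α → Prop} (hr : Relator.RightUnique r)
    (hl : Relator.LeftUnique r) {x y : α} (h : EqvGen r x y) :
    ReflTransGen r x y ∨ ReflTransGen r y x := by
  induction h with
  | rel x y h => exact Or.inl (.single h)
  | refl x => exact Or.inl .refl
  | symm x y _ ih => exact ih.symm
  | trans x y z _ _ ih₁ ih₂ =>
    rcases ih₁ with h₁ | h₁ <;> rcases ih₂ with h₂ | h₂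
    · exact Or.inl (h₁.trans h₂)
    · have := ReflTransGen.total_of_right_unique (r := Function.swap r)
        (fun _ _ _ h h' ↦ hl h h') (reflTransGen_swap.2 h₁) (reflTransGen_swap.2 h₂)
      exact this.symm.imp reflTransGen_swap.1 reflTransGen_swap.1
    · exact ReflTransGen.total_of_right_unique hr h₁ h₂
    · exact Or.inr (h₂.trans h₁)

theorem map_positions_eq {n : ι → ℕ} {a b : List ι} (ha : a.Nodup) (hb : b.Nodup)
    (hlen : (positions n a).length = (positions n b).length) {D : Type} {F : ι × ℕ → D}
    (hF : ∀ s t, Linked n a b s t → F s = F t) :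
    (positions n a).map F = (positions n b).map F := by
  refine List.ext_getElem (by simpa using hlen) fun p h₁ h₂ ↦ ?_
  rw [List.length_map] at h₁ h₂
  rw [List.getElem_map, List.getElem_map]
  refine hF _ _ ⟨List.getElem_mem _, List.getElem_mem _, ?_⟩
  rw [(nodup_positions n ha).idxOf_getElem p h₁, (nodup_positions n hb).idxOf_getElem p h₂]

theorem Linked.letterAt_eq {g : ι → List C} {a b : List ι}
    (h : a.flatMap g = b.flatMap g) {s t : ι × ℕ}
    (hst : Linked (fun i ↦ (g i).length) a b s t) : letterAt g s = letterAt g t := by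
  obtain ⟨hs, ht, h'⟩ := hst
  have hm : (positions (fun i ↦ (g i).length) a).map (letterAt g) =
      (positions (fun i ↦ (g i).length) b).map (letterAt g) := by
    rw [map_letterAt_positions, map_letterAt_positions, h]
  have h₁ := congrArg (·[(positions (fun i ↦ (g i).length) a).idxOf s]?) hm
  simp only [List.getElem?_map] at h₁
  rw [List.getElem?_idxOf hs, h', List.getElem?_idxOf ht] at h₁
  simpa using h₁

/-- Deleting a set of positions that is closed under `Linked` from a solution gives a solution. -/
theorem exists_deletion {g : ι → List C} {a b : List ι} (ha : a.Nodup) (hb : b.Nodup)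
    (h : a.flatMap g = b.flatMap g) {P : ι × ℕ → Prop}
    (hP : ∀ s t, Linked (fun i ↦ (g i).length) a b s t → (P s ↔ P t)) :
    ∃ g' : ι → List C, a.flatMap g' = b.flatMap g' ∧
      (∀ i, (∀ o, P (i, o)) → g' i = g i) ∧
      ∀ i ∈ a ++ b, ∀ o < (g i).length, ¬ P (i, o) →
        (a.flatMap g').length < (a.flatMap g).length := by
  classical
  let F (s : ι × ℕ) : Option C := if P s then letterAt g s else none
  let g' (i : ι) : List C := (List.range (g i).length).filterMap fun o ↦ F (i, o)
  have hg' (l : List ι) : l.flatMap g' = ((positions (fun i ↦ (g i).length) l).map F).filterMap id := by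
    simp only [positions, List.filterMap_map, List.filterMap_flatMap, g']
    rfl
  have h' : a.flatMap g' = b.flatMap g' := by
    rw [hg', hg', map_positions_eq ha hb]
    · rw [length_positions, length_positions, h]
    · intro s t hst
      simp only [F, hP s t hst, hst.letterAt_eq h]
  refine ⟨g', h', fun i hi ↦ ?_, fun i hi o ho hPo ↦ ?_⟩
  · simp only [g', F, hi, if_true, letterAt]
    have := congrArg (List.filterMap id) (map_range_getElem? (g i))
    simpa [List.filterMap_map, Function.comp_def] using this
  · have hlt (l : List ι) (hi : i ∈ l) : (l.flatMap g').length < (l.flatMap g).length := by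
      rw [hg', List.filterMap_map, ← length_positions, List.length_filterMap_eq_countP]
      refine List.countP_lt_length_iff.2 ⟨(i, o), mem_positions.2 ⟨hi, ho⟩, ?_⟩
      simp [F, hPo]
    rcases List.mem_append.1 hi with hi | hi
    · exact hlt a hi
    · rw [h', h]
      exact hlt b hi

/-- Positions on common blocks are in the same order on both sides. -/
theorem idxOf_positions_lt {n : ι → ℕ} {a b : List ι} (ha : a.Nodup) (hb : b.Nodup)
    (hab : a.filter (· ∈ b) = b.filter (· ∈ a)) {s t : ι × ℕ}
    (hsa : s ∈ positions n a) (hsb : s ∈ positions n b) (hta : t ∈ positions n a)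
    (htb : t ∈ positions n b) (h : (positions n b).idxOf s < (positions n b).idxOf t) :
    (positions n a).idxOf s < (positions n a).idxOf t := by
  have hsub (l : List ι) (p : ι → Bool) :
      (positions n (l.filter p)).Sublist (positions n l) :=
    List.filter_sublist.flatMap _
  have hpair {l : List ι} (hl : l.Nodup) :
      (positions n l).Pairwise fun s t ↦ (positions n l).idxOf s < (positions n l).idxOf t := by
    refine List.pairwise_iff_getElem.2 fun i j hi hj hij ↦ ?_
    rwa [(nodup_positions n hl).idxOf_getElem i hi, (nodup_positions n hl).idxOf_getElem j hj]
  have h₁ := (hpair ha).sublist (hsub a fun i ↦ decide (i ∈ b))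
  have h₂ := (hpair hb).sublist (hsub b fun i ↦ decide (i ∈ a))
  rw [← hab] at h₂
  have h₃ := (h₁.and h₂).imp (S := fun s t ↦
    ((positions n a).idxOf s < (positions n a).idxOf t ∧
      (positions n b).idxOf s < (positions n b).idxOf t) ∨
    ((positions n a).idxOf t < (positions n a).idxOf s ∧
      (positions n b).idxOf t < (positions n b).idxOf s)) fun h ↦ Or.inl h
  have : Std.Symm (fun s t ↦
    ((positions n a).idxOf s < (positions n a).idxOf t ∧
      (positions n b).idxOf s < (positions n b).idxOf t) ∨
    ((positions n a).idxOf t < (positions n a).idxOf s ∧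
      (positions n b).idxOf t < (positions n b).idxOf s)) := ⟨fun _ _ h ↦ h.symm⟩
  have hmem {s : ι × ℕ} (h : s ∈ positions n a) (h' : s ∈ positions n b) :
      s ∈ positions n (a.filter (· ∈ b)) := by
    rw [mem_positions] at *
    simpa [h.1, h.2] using h'.1
  have hne : s ≠ t := by
    rintro rfl
    exact h.false
  have := h₃.forall (hmem hsa hsb) (hmem hta htb) hne
  omega

/-- If the two occurrences of a block are disjoint, then a chain of linked positions that leaves the
block does not come back to it, because it moves on in one direction. -/
theorem not_transGen_linked {g : ι → List C} {a b : List ι} (ha : a.Nodup) (hb : b.Nodup)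
    (hab : a.filter (· ∈ b) = b.filter (· ∈ a)) {i : ι}
    (hi : i ∈ a → i ∈ b → ∀ a₁ a₂ b₁ b₂, a = a₁ ++ i :: a₂ → b = b₁ ++ i :: b₂ →
      (a₁.flatMap g).length + (g i).length < (b₁.flatMap g).length ∨
      (b₁.flatMap g).length + (g i).length < (a₁.flatMap g).length) {o o' : ℕ} :
    ¬ TransGen (Linked (fun i ↦ (g i).length) a b) (i, o) (i, o') := by
  intro h
  set n : ι → ℕ := fun i ↦ (g i).length
  obtain ⟨_, hA, -⟩ := TransGen.head'_iff.1 h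
  obtain ⟨_, -, hB⟩ := TransGen.tail'_iff.1 h
  replace hA : (i, o) ∈ positions n a := hA.1
  replace hB : (i, o') ∈ positions n b := hB.2.1
  have hia := (mem_positions.1 hA).1
  have hib := (mem_positions.1 hB).1
  have ho : o < (g i).length := (mem_positions.1 hA).2
  have ho' : o' < (g i).length := (mem_positions.1 hB).2
  have hA' : (i, o) ∈ positions n b := mem_positions.2 ⟨hib, ho⟩
  have hpos : ((positions n a).idxOf (i, o) < (positions n b).idxOf (i, o') ∧
        (positions n a).idxOf (i, o) < (positions n b).idxOf (i, o)) ∨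
      ((positions n b).idxOf (i, o') < (positions n a).idxOf (i, o) ∧
        (positions n b).idxOf (i, o) < (positions n a).idxOf (i, o)) := by
    obtain ⟨a₁, a₂, rfl, ha₁⟩ := List.eq_append_cons_of_mem hia
    obtain ⟨b₁, b₂, rfl, hb₁⟩ := List.eq_append_cons_of_mem hib
    have := hi hia hib a₁ a₂ b₁ b₂ rfl rfl
    rw [idxOf_positions ha₁ ho, idxOf_positions hb₁ ho, idxOf_positions hb₁ ho']
    omega
  rcases hpos with ⟨hlt, hd⟩ | ⟨hlt, hd⟩
  · have key : ∀ t, TransGen (Linked n a b) (i, o) t →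
        (positions n b).idxOf t ≤ (positions n a).idxOf (i, o) := by
      intro t ht
      induction ht with
      | single h => exact h.2.2.symm.le
      | @tail t t' h₁ h₂ ih =>
        obtain ⟨_, -, h₃⟩ := TransGen.tail'_iff.1 h₁
        have := idxOf_positions_lt ha hb hab h₂.1 h₃.2.1 hA hA' (ih.trans_lt hd)
        have := h₂.2.2
        omega
    have := key _ h
    omega
  · have key : ∀ t, TransGen (Linked n a b) (i, o) t →
        (positions n a).idxOf (i, o) ≤ (positions n b).idxOf t := by
      intro t ht
      induction ht with
      | single h => exact h.2.2.le
      | @tail t t' h₁ h₂ ih =>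
        obtain ⟨_, -, h₃⟩ := TransGen.tail'_iff.1 h₁
        have := idxOf_positions_lt ha hb hab hA hA' h₂.1 h₃.2.1 (hd.trans_le ih)
        have := h₂.2.2
        omega
    have := key _ h
    omega

/-- Suppose that `g` solves the block equation `a = b`, in which no block is repeated on a side and
the common blocks are in the same order on both sides. Then the blocks that are not `rigid` can be
filled anew with words whose lengths are bounded by the number of blocks, and whose letters come
from rigid blocks. -/
theorem exists_short_blocks {a b : List ι} (ha : a.Nodup) (hb : b.Nodup)
    (hab : a.filter (· ∈ b) = b.filter (· ∈ a)) (rigid : ι → Prop) (g : ι → List C)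
    (hg : ∀ i, rigid i → (g i).length ≤ 1) (h : a.flatMap g = b.flatMap g) :
    ∃ g' : ι → List C, (∀ i, rigid i → g' i = g i) ∧ a.flatMap g' = b.flatMap g' ∧
      ∀ i ∈ a ++ b, (g' i).length ≤ a.length + b.length ∧
        ∀ c ∈ g' i, ∃ j ∈ a ++ b, rigid j ∧ c ∈ g j := by
  induction hN : (a.flatMap g).length using Nat.strong_induction_on generalizing g with
  | _ N ih =>
  subst hN
  by_cases hmin : ∃ g' : ι → List C, (∀ i, rigid i → g' i = g i) ∧ a.flatMap g' = b.flatMap g' ∧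
      (a.flatMap g').length < (a.flatMap g).length
  · obtain ⟨g', hrig, h', hlt⟩ := hmin
    obtain ⟨g'', hrig', h'', hb⟩ := ih _ hlt g' (fun i hi ↦ by rw [hrig i hi]; exact hg i hi) h' rfl
    refine ⟨g'', fun i hi ↦ (hrig' i hi).trans (hrig i hi), h'', fun i hi ↦ ⟨(hb i hi).1, ?_⟩⟩
    intro c hc
    obtain ⟨j, hj, hr, hc⟩ := (hb i hi).2 c hc
    exact ⟨j, hj, hr, by rwa [hrig j hr] at hc⟩
  refine ⟨g, fun _ _ ↦ rfl, h, ?_⟩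
  set n : ι → ℕ := fun i ↦ (g i).length
  -- By minimality no two occurrences of a block overlap,
  have hfar : ∀ i, ¬ rigid i → 0 < (g i).length → i ∈ a → i ∈ b → ∀ a₁ a₂ b₁ b₂,
      a = a₁ ++ i :: a₂ → b = b₁ ++ i :: b₂ →
      (a₁.flatMap g).length + (g i).length < (b₁.flatMap g).length ∨
      (b₁.flatMap g).length + (g i).length < (a₁.flatMap g).length := by
    rintro i hr hpos hia hib a₁ a₂ b₁ b₂ rfl rfl
    by_contra! hcon
    have ha' := List.nodup_middle.1 ha
    have hb' := List.nodup_middle.1 hb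
    rw [List.nodup_cons, List.mem_append, not_or] at ha' hb'
    obtain ⟨u, hu, hu'⟩ : ∃ u : List C, u.length < (g i).length ∧
        (a₁ ++ i :: a₂).flatMap (Function.update g i u) =
          (b₁ ++ i :: b₂).flatMap (Function.update g i u) := by
      rcases le_total (a₁.flatMap g).length (b₁.flatMap g).length with hle | hle
      · exact exists_shorter_block ha'.1.1 ha'.1.2 hb'.1.1 hb'.1.2 h hpos hle hcon.1
      · obtain ⟨u, hu, hu'⟩ :=
          exists_shorter_block hb'.1.1 hb'.1.2 ha'.1.1 ha'.1.2 h.symm hpos hle hcon.2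
        exact ⟨u, hu, hu'.symm⟩
    refine hmin ⟨Function.update g i u, fun j hj ↦ Function.update_of_ne ?_ _ _, hu', ?_⟩
    · rintro rfl
      exact hr hj
    · have hupd (l : List ι) (hl : i ∉ l) : l.flatMap (Function.update g i u) = l.flatMap g :=
        List.flatMap_congr fun j hj ↦ Function.update_of_ne (ne_of_mem_of_not_mem hj hl) _ _
      simp only [List.flatMap_append, List.flatMap_cons, hupd _ ha'.1.1, hupd _ ha'.1.2,
        Function.update_self, List.length_append]
      omega
  -- and each position is connected with a position in a rigid block.
  have hconn : ∀ i ∈ a ++ b, ∀ o < (g i).length,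
      ∃ c : ι × ℕ, rigid c.1 ∧ EqvGen (Linked n a b) (i, o) c := by
    by_contra! hcon
    obtain ⟨i, hi, o, ho, hcon⟩ := hcon
    obtain ⟨g', h', hrig, hlt⟩ := exists_deletion ha hb h
      (P := fun s ↦ ∃ c : ι × ℕ, rigid c.1 ∧ EqvGen (Linked n a b) s c) fun s t hst ↦
        ⟨fun ⟨c, hc, hsc⟩ ↦ ⟨c, hc, (EqvGen.symm _ _ (.rel _ _ hst)).trans _ _ _ hsc⟩,
          fun ⟨c, hc, hsc⟩ ↦ ⟨c, hc, (EqvGen.rel _ _ hst).trans _ _ _ hsc⟩⟩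
    exact hmin ⟨g', fun j hj ↦ hrig j fun o ↦ ⟨(j, o), hj, .refl _⟩, h', hlt i hi o ho
      fun ⟨c, hc, hsc⟩ ↦ hcon c hc hsc⟩
  have hinv : ∀ s t, EqvGen (Linked n a b) s t → letterAt g s = letterAt g t ∧
      (s.1 ∈ a ++ b → t.1 ∈ a ++ b) ∧ (t.1 ∈ a ++ b → s.1 ∈ a ++ b) := by
    intro s t hst
    induction hst with
    | rel s t hst =>
      exact ⟨hst.letterAt_eq h, fun _ ↦ List.mem_append_right _ (mem_positions.1 hst.2.1).1,
        fun _ ↦ List.mem_append_left _ (mem_positions.1 hst.1).1⟩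
    | refl s => exact ⟨rfl, id, id⟩
    | symm s t _ ih => exact ⟨ih.1.symm, ih.2.2, ih.2.1⟩
    | trans s t u _ _ ih₁ ih₂ =>
      exact ⟨ih₁.1.trans ih₂.1, ih₂.2.1 ∘ ih₁.2.1, ih₁.2.2 ∘ ih₂.2.2⟩
  intro i hi
  have hone : 1 ≤ a.length + b.length := by
    rw [← List.length_append]
    exact List.length_pos_of_mem hi
  constructor
  · by_cases hr : rigid i
    · exact (hg i hr).trans hone
    have : Nonempty ι := ⟨i⟩
    choose! f hf hconn using hconn i hi
    have hfn : ∀ o < (g i).length, (f o).1 ∈ a ++ b ∧ (f o).2 = 0 := by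
      intro o ho
      obtain ⟨hl, hm, -⟩ := hinv _ _ (hconn o ho)
      refine ⟨hm hi, ?_⟩
      have hlen : (f o).2 < (g (f o).1).length := by
        have h₁ : letterAt g (i, o) = some (g i)[o] := List.getElem?_eq_getElem ho
        rw [h₁] at hl
        exact (List.getElem?_eq_some_iff.1 hl.symm).1
      have := hg _ (hf o ho)
      omega
    have hinj : Set.InjOn (fun o ↦ (f o).1) (Finset.range (g i).length : Set ℕ) := by
      intro o ho o' ho' hoo'
      rw [Finset.coe_range, Set.mem_Iio] at ho ho'
      have hf' : f o = f o' := Prod.ext hoo' ((hfn o ho).2.trans (hfn o' ho').2.symm)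
      have heq : EqvGen (Linked n a b) (i, o) (i, o') :=
        (hconn o ho).trans _ _ _ (.symm _ _ (hf' ▸ hconn o' ho'))
      have hfar := hfar i hr (by omega)
      by_contra hne
      rcases reflTransGen_or_of_eqvGen (Linked.rightUnique n a b) (Linked.leftUnique n a b) heq
        with hc | hc
      · rcases reflTransGen_iff_eq_or_transGen.1 hc with hc | hc
        · exact hne (Prod.mk.inj hc).2.symm
        · exact not_transGen_linked ha hb hab hfar hc
      · rcases reflTransGen_iff_eq_or_transGen.1 hc with hc | hc
        · exact hne (Prod.mk.inj hc).2
        · exact not_transGen_linked ha hb hab hfar hc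
    have := Finset.card_le_card_of_injOn (s := Finset.range (g i).length)
      (t := (a ++ b).toFinset) (fun o ↦ (f o).1)
      (fun o ho ↦ List.mem_toFinset.2 (hfn o (by simpa using ho)).1) hinj
    rw [Finset.card_range] at this
    exact this.trans ((List.toFinset_card_le _).trans (by simp))
  · intro c hc
    obtain ⟨o, ho, rfl⟩ := List.getElem_of_mem hc
    obtain ⟨⟨j, q⟩, hj, hij⟩ := hconn i hi o ho
    obtain ⟨hl, hm, -⟩ := hinv _ _ hij
    have h₁ : letterAt g (i, o) = some (g i)[o] := List.getElem?_eq_getElem ho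
    rw [h₁] at hl
    exact ⟨j, hm hi, hj, List.mem_of_getElem? hl.symm⟩

end Blocks

end WordEq

/-! ### Patterns and equations -/

namespace WordEq

section Equations

variable {C : Type}

/-- The variables of a pattern, in the order of their occurrences. -/
def Pattern.vars (α : Pattern C) : List ℕ :=
  α.filterMap fun s ↦ match s with
    | .const _ => none
    | .var x => some x

@[simp]
theorem Pattern.vars_nil : Pattern.vars ([] : Pattern C) = [] := rfl

@[simp]
theorem Pattern.vars_const (a : C) (α : Pattern C) :
    Pattern.vars (.const a :: α) = Pattern.vars α := rfl

@[simp]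
theorem Pattern.vars_var (x : ℕ) (α : Pattern C) :
    Pattern.vars (.var x :: α) = x :: Pattern.vars α := rfl

theorem Pattern.mem_vars {α : Pattern C} {x : ℕ} : x ∈ Pattern.vars α ↔ .var x ∈ α := by
  induction α with
  | nil => simp
  | cons s α ih => cases s <;> simp [ih]

theorem Pattern.isRegular_iff {α : Pattern C} :
    Pattern.IsRegular α ↔ (Pattern.vars α).Nodup := by
  rw [Pattern.vars, List.Nodup, List.pairwise_filterMap, List.pairwise_iff_getElem]
  constructor
  · rintro h i j hi hj hij x hx y hy rfl
    have hi' : α[i]? = some (.var x) := by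
      rw [List.getElem?_eq_getElem hi]
      rcases hs : α[i] with _ | z <;> simp_all
    have hj' : α[j]? = some (.var x) := by
      rw [List.getElem?_eq_getElem hj]
      rcases hs : α[j] with _ | z <;> simp_all
    exact hij.ne (h x i j hi' hj')
  · intro h x i j hi hj
    obtain ⟨hi', hi⟩ := List.getElem?_eq_some_iff.1 hi
    obtain ⟨hj', hj⟩ := List.getElem?_eq_some_iff.1 hj
    by_contra hne
    rcases lt_or_gt_of_ne hne with hlt | hlt
    · exact h i j hi' hj' hlt x (by simp [hi]) x (by simp [hj]) rfl
    · exact h j i hj' hi' hlt x (by simp [hj]) x (by simp [hi]) rfl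

theorem Pattern.pairwise_before {α : Pattern C} (h : Pattern.IsRegular α) :
    (Pattern.vars α).Pairwise (Pattern.Before α) := by
  rw [Pattern.vars, List.pairwise_filterMap, List.pairwise_iff_getElem]
  intro i j hi hj hij x hx y hy k l hk hl
  have hi' : α[i]? = some (.var x) := by
    rw [List.getElem?_eq_getElem hi]
    rcases hs : α[i] with _ | z <;> simp_all
  have hj' : α[j]? = some (.var y) := by
    rw [List.getElem?_eq_getElem hj]
    rcases hs : α[j] with _ | z <;> simp_all
  rwa [h x k i hk hi', h y l j hl hj']

theorem Pattern.Before.asymm {α : Pattern C} {x y : ℕ} (hx : x ∈ Pattern.vars α)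
    (hy : y ∈ Pattern.vars α) (h : Pattern.Before α x y) : ¬ Pattern.Before α y x := by
  obtain ⟨i, hi⟩ := List.mem_iff_getElem?.1 (Pattern.mem_vars.1 hx)
  obtain ⟨j, hj⟩ := List.mem_iff_getElem?.1 (Pattern.mem_vars.1 hy)
  exact fun h' ↦ (h i j hi hj).asymm (h' j i hj hi)

/-- A regular equation is ordered iff the sequences of the common variables on both sides are the
same. -/
theorem Equation.isOrdered_iff {E : Equation C} (h : E.IsRegular) :
    E.IsOrdered ↔ (Pattern.vars E.lhs).filter (· ∈ Pattern.vars E.rhs) =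
      (Pattern.vars E.rhs).filter (· ∈ Pattern.vars E.lhs) := by
  have h₁ := (Pattern.pairwise_before h.1).sublist
    (List.filter_sublist (p := fun x ↦ decide (x ∈ Pattern.vars E.rhs)))
  have h₂ := (Pattern.pairwise_before h.2).sublist
    (List.filter_sublist (p := fun x ↦ decide (x ∈ Pattern.vars E.lhs)))
  constructor
  · intro hord
    refine List.Perm.eq_of_pairwise (le := Pattern.Before E.lhs) ?_ h₁ ?_ ?_
    · intro x y hx hy hxy hyx
      simp only [List.mem_filter, decide_eq_true_eq] at hx hy
      exact (hxy.asymm hx.1 hy.2 hyx).elim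
    · refine h₂.imp_of_mem fun {x y} hx hy hxy ↦ ?_
      simp only [List.mem_filter, decide_eq_true_eq, Pattern.mem_vars] at hx hy
      exact (hord x y hx.2 hx.1 hy.2 hy.1).2 hxy
    · refine (List.perm_ext_iff_of_nodup ((Pattern.isRegular_iff.1 h.1).filter _)
        ((Pattern.isRegular_iff.1 h.2).filter _)).2 fun x ↦ ?_
      simp [and_comm]
  · intro heq x y hx hx' hy hy'
    simp only [← Pattern.mem_vars] at hx hx' hy hy'
    by_cases hxy : x = y
    · subst hxy
      exact ⟨fun h ↦ (h.asymm hx hx h).elim, fun h ↦ (h.asymm hx' hx' h).elim⟩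
    rw [← heq] at h₂
    have h₃ := (h₁.and h₂).imp (S := fun x y ↦
      (Pattern.Before E.lhs x y ∧ Pattern.Before E.rhs x y) ∨
      (Pattern.Before E.lhs y x ∧ Pattern.Before E.rhs y x)) fun h ↦ Or.inl h
    have : Std.Symm (fun x y ↦
      (Pattern.Before E.lhs x y ∧ Pattern.Before E.rhs x y) ∨
      (Pattern.Before E.lhs y x ∧ Pattern.Before E.rhs y x)) := ⟨fun _ _ h ↦ h.symm⟩
    rcases h₃.forall (a := x) (by simp [hx, hx']) (b := y) (by simp [hy, hy']) hxy with h | h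
    · exact ⟨fun _ ↦ h.2, fun _ ↦ h.1⟩
    · exact ⟨fun h' ↦ (h'.asymm hx hy h.1).elim, fun h' ↦ (h'.asymm hx' hy' h.2).elim⟩

/-- The blocks of a pattern, one for each symbol: variables are blocks, and each occurrence of a
constant is a block of its own, which is named by the side of the equation and the index. -/
def Pattern.blocks (side : Bool) : ℕ → Pattern C → List ((Bool × ℕ) ⊕ ℕ)
  | _, [] => []
  | n, .const _ :: α => .inl (side, n) :: Pattern.blocks side (n + 1) α
  | n, .var x :: α => .inr x :: Pattern.blocks side (n + 1) α

theorem Pattern.length_blocks (side : Bool) (n : ℕ) (α : Pattern C) :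
    (Pattern.blocks side n α).length = α.length := by
  induction α generalizing n with
  | nil => rfl
  | cons s α ih => cases s <;> simp [Pattern.blocks, ih]

theorem Pattern.inr_mem_blocks {side : Bool} {n : ℕ} {α : Pattern C} {x : ℕ} :
    .inr x ∈ Pattern.blocks side n α ↔ x ∈ Pattern.vars α := by
  induction α generalizing n with
  | nil => simp [Pattern.blocks]
  | cons s α ih => cases s <;> simp [Pattern.blocks, ih]

theorem Pattern.inl_mem_blocks {side side' : Bool} {n m : ℕ} {α : Pattern C}
    (h : .inl (side', m) ∈ Pattern.blocks side n α) : side' = side ∧ n ≤ m := by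
  induction α generalizing n with
  | nil => simp [Pattern.blocks] at h
  | cons s α ih =>
    rcases s with _ | x
    · rcases List.mem_cons.1 h with h | h
      · simp only [Sum.inl.injEq, Prod.mk.injEq] at h
        exact ⟨h.1, h.2.ge⟩
      · have := ih h
        exact ⟨this.1, by omega⟩
    · rcases List.mem_cons.1 h with h | h
      · simp at h
      · have := ih h
        exact ⟨this.1, by omega⟩

theorem Pattern.nodup_blocks {side : Bool} {n : ℕ} {α : Pattern C}
    (h : (Pattern.vars α).Nodup) : (Pattern.blocks side n α).Nodup := by
  induction α generalizing n with
  | nil => exact List.nodup_nil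
  | cons s α ih =>
    rcases s with _ | x
    · refine List.nodup_cons.2 ⟨fun hm ↦ ?_, ih h⟩
      have := (Pattern.inl_mem_blocks hm).2
      omega
    · rw [Pattern.vars_var, List.nodup_cons] at h
      exact List.nodup_cons.2 ⟨fun hm ↦ h.1 (Pattern.inr_mem_blocks.1 hm), ih h.2⟩

theorem Pattern.filter_blocks {side : Bool} {n : ℕ} {α : Pattern C}
    {p : (Bool × ℕ) ⊕ ℕ → Bool} {q : ℕ → Bool} (hl : ∀ m, p (.inl (side, m)) = false)
    (hr : ∀ x, p (.inr x) = q x) :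
    (Pattern.blocks side n α).filter p = ((Pattern.vars α).filter q).map .inr := by
  induction α generalizing n with
  | nil => rfl
  | cons s α ih =>
    rcases s with _ | x
    · simp [Pattern.blocks, hl, ih]
    · cases hq : q x <;> simp [Pattern.blocks, hr, ih, hq]

theorem Pattern.flatMap_blocks {side : Bool} {n : ℕ} {α : Pattern C}
    {g : (Bool × ℕ) ⊕ ℕ → List C}
    (hl : ∀ m a, α[m]? = some (.const a) → g (.inl (side, n + m)) = [a]) :
    (Pattern.blocks side n α).flatMap g = Pattern.image (fun x ↦ g (.inr x)) α := by
  induction α generalizing n with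
  | nil => rfl
  | cons s α ih =>
    have ih := ih (n := n + 1) fun m a h ↦ by
      rw [add_assoc, add_comm 1]
      exact hl (m + 1) a (by simpa using h)
    rcases s with a | x
    · have := hl 0 a rfl
      rw [add_zero] at this
      simp [Pattern.blocks, Pattern.image, Symbol.image, this, ih]
    · simp [Pattern.blocks, Pattern.image, Symbol.image, ih]

/-- A satisfiable regular-ordered equation has a solution in which the lengths of the images of its
variables are at most the length of the equation, and only letters of the equation are used. -/
theorem Equation.exists_short_solution {E : Equation C} (hreg : E.IsRegular) (hord : E.IsOrdered)
    (hsat : E.IsSatisfiable) :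
    ∃ h : ℕ → List C, E.IsSolution h ∧ ∀ x ∈ Pattern.vars E.lhs ++ Pattern.vars E.rhs,
      (h x).length ≤ E.lhs.length + E.rhs.length ∧ ∀ a ∈ h x, .const a ∈ E.lhs ++ E.rhs := by
  obtain ⟨h, hsol⟩ := hsat
  let S (side : Bool) : Pattern C := bif side then E.rhs else E.lhs
  let g : (Bool × ℕ) ⊕ ℕ → List C
    | .inl (side, m) => match (S side)[m]? with
      | some (.const a) => [a]
      | _ => []
    | .inr x => h x
  have hgl (side : Bool) (m : ℕ) (a : C) (ha : (S side)[m]? = some (.const a)) :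
      g (.inl (side, m)) = [a] := by
    simp only [g, ha]
  have hgl' (side : Bool) (m : ℕ) (a : C) (ha : a ∈ g (.inl (side, m))) :
      .const a ∈ S side := by
    simp only [g] at ha
    split at ha
    · next a' h' =>
      rw [List.mem_singleton] at ha
      subst ha
      exact List.mem_of_getElem? h'
    · simp at ha
  have hlhs := Pattern.flatMap_blocks (side := false) (n := 0) (α := E.lhs) (g := g)
    fun m a ha ↦ by rw [zero_add]; exact hgl false m a ha
  have hrhs := Pattern.flatMap_blocks (side := true) (n := 0) (α := E.rhs) (g := g)
    fun m a ha ↦ by rw [zero_add]; exact hgl true m a ha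
  have hfil := (Equation.isOrdered_iff hreg).1 hord
  obtain ⟨g', hrig, hg', hshort⟩ := exists_short_blocks
    (Pattern.nodup_blocks (side := false) (n := 0) (Pattern.isRegular_iff.1 hreg.1))
    (Pattern.nodup_blocks (side := true) (n := 0) (Pattern.isRegular_iff.1 hreg.2))
    (by
      rw [Pattern.filter_blocks (q := fun x ↦ decide (x ∈ Pattern.vars E.rhs)),
        Pattern.filter_blocks (q := fun x ↦ decide (x ∈ Pattern.vars E.lhs)), hfil]
      · exact fun m ↦ decide_eq_false_iff_not.2 fun hm ↦ by simpa using (Pattern.inl_mem_blocks hm).1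
      · exact fun x ↦ by simp only [Pattern.inr_mem_blocks]
      · exact fun m ↦ decide_eq_false_iff_not.2 fun hm ↦ by simpa using (Pattern.inl_mem_blocks hm).1
      · exact fun x ↦ by simp only [Pattern.inr_mem_blocks])
    (fun i ↦ i.isLeft = true) g
    (by
      rintro (⟨side, m⟩ | x) hi
      · simp only [g]
        split <;> simp
      · simp at hi)
    (by rw [hlhs, hrhs]; exact hsol)
  refine ⟨fun x ↦ g' (.inr x), ?_, fun x hx ↦ ?_⟩
  · rwa [Pattern.flatMap_blocks, Pattern.flatMap_blocks] at hg'
    · intro m a ha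
      rw [hrig _ rfl, zero_add]
      exact hgl true m a ha
    · intro m a ha
      rw [hrig _ rfl, zero_add]
      exact hgl false m a ha
  · have hx' : .inr x ∈ Pattern.blocks false 0 E.lhs ++ Pattern.blocks true 0 E.rhs := by
      simpa only [List.mem_append, Pattern.inr_mem_blocks] using hx
    obtain ⟨hlen, hlet⟩ := hshort _ hx'
    rw [Pattern.length_blocks, Pattern.length_blocks] at hlen
    refine ⟨hlen, fun a ha ↦ ?_⟩
    obtain ⟨⟨side, m⟩ | y, -, hj, haj⟩ := hlet a ha
    · have := hgl' side m a haj
      cases side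
      · exact List.mem_append_left _ this
      · exact List.mem_append_right _ this
    · simp at hj

end Equations

end WordEq

/-! ### Encodings -/

namespace WordEq

open scoped Computability

theorem bits_injective : Function.Injective Nat.bits := fun m n h ↦
  Nat.eq_of_testBit_eq fun i ↦ by rw [Nat.testBit_eq_inth, Nat.testBit_eq_inth, h]

theorem exists_bits_eq_append_true (l : List Bool) : ∃ n ≠ 0, Nat.bits n = l ++ [true] := by
  induction l with
  | nil => exact ⟨1, one_ne_zero, Nat.one_bits⟩
  | cons b l ih =>
    obtain ⟨n, hn, h⟩ := ih
    refine ⟨Nat.bit b n, fun h0 ↦ hn ?_, ?_⟩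
    · exact (Nat.bit_eq_zero_iff.1 h0).1
    · rw [Nat.bits_append_bit n b fun h0 ↦ (hn h0).elim, h, List.cons_append]

theorem bits_eq_nil_or_append_true (n : ℕ) : Nat.bits n = [] ∨ ∃ l, Nat.bits n = l ++ [true] := by
  induction n using Nat.binaryRec' with
  | zero => exact Or.inl Nat.zero_bits
  | bit b n hb ih =>
    rw [Nat.bits_append_bit n b hb]
    right
    rcases ih with h | ⟨l, h⟩
    · have hn : n = 0 := bits_injective (h.trans Nat.zero_bits.symm)
      exact ⟨[], by rw [h, hb hn, List.nil_append]⟩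
    · exact ⟨b :: l, by rw [h, List.cons_append]⟩

/-- The words that write a number in binary without superfluous zeros. -/
def bitsLang : Language Token := {w | ∃ n : ℕ, (Nat.bits n).map .bit = w}

theorem isRegular_bitsLang : bitsLang.IsRegular := by
  have h : bitsLang = 1 + ({[.bit true]} + {[.bit false]})∗ * {[.bit true]} := by
    ext w
    rw [Language.mem_add, Language.mem_one, Language.mem_mul]
    constructor
    · rintro ⟨n, rfl⟩
      rcases bits_eq_nil_or_append_true n with h | ⟨l, h⟩
      · exact Or.inl (by simp [h])
      · refine Or.inr ⟨l.map .bit, ⟨l.map fun b ↦ [.bit b], ?_, ?_⟩, [.bit true], rfl, by simp [h]⟩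
        · rw [← List.flatMap_def]
          exact List.map_eq_flatMap
        · intro y hy
          obtain ⟨b, -, rfl⟩ := List.mem_map.1 hy
          cases b
          · exact Or.inr rfl
          · exact Or.inl rfl
    · rintro (rfl | ⟨_, ⟨l, rfl, hl⟩, _, rfl, rfl⟩)
      · exact ⟨0, by simp⟩
      · have : ∃ m : List Bool, m.map Token.bit = l.flatten := by
          induction l with
          | nil => exact ⟨[], rfl⟩
          | cons a l ih =>
            obtain ⟨m, hm⟩ := ih fun y hy ↦ hl y (List.mem_cons_of_mem _ hy)
            rcases hl a List.mem_cons_self with h | h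
            · exact ⟨true :: m, by rw [List.flatten_cons, ← hm, show a = [.bit true] from h]; rfl⟩
            · exact ⟨false :: m, by rw [List.flatten_cons, ← hm, show a = [.bit false] from h]; rfl⟩
        obtain ⟨m, hm⟩ := this
        obtain ⟨n, -, hn⟩ := exists_bits_eq_append_true m
        exact ⟨n, by rw [hn, List.map_append, hm]; rfl⟩
  rw [h]
  exact (Language.isRegular_singleton []).add (((Language.isRegular_singleton _).add
    (Language.isRegular_singleton _)).kstar.mul (Language.isRegular_singleton _))

variable {k : ℕ∞}

/-- The encodings of the variables. -/
def varLang : Language Token := {w | ∃ x : ℕ, .var :: (Nat.bits x).map .bit = w}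

/-- The encodings of the constants. -/
def constLang (k : ℕ∞) : Language Token :=
  {w | ∃ a : Letter k, Symbol.encode (Symbol.const a) = w}

theorem isRegular_varLang : varLang.IsRegular := by
  have h : varLang = {[.var]} * bitsLang := by
    ext w
    rw [Language.mem_mul]
    constructor
    · rintro ⟨x, rfl⟩
      exact ⟨_, rfl, _, ⟨x, rfl⟩, rfl⟩
    · rintro ⟨_, rfl, _, ⟨x, rfl⟩, rfl⟩
      exact ⟨x, rfl⟩
  rw [h]
  exact (Language.isRegular_singleton _).mul isRegular_bitsLang

theorem isRegular_constLang (k : ℕ∞) : (constLang k).IsRegular := by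
  rcases eq_or_ne k ⊤ with rfl | hk
  · have h : constLang ⊤ = {[.const]} * bitsLang := by
      ext w
      rw [Language.mem_mul]
      constructor
      · rintro ⟨a, rfl⟩
        exact ⟨_, rfl, _, ⟨a, rfl⟩, rfl⟩
      · rintro ⟨_, rfl, _, ⟨a, rfl⟩, rfl⟩
        exact ⟨⟨a, ENat.natCast_lt_top a⟩, rfl⟩
    rw [h]
    exact (Language.isRegular_singleton _).mul isRegular_bitsLang
  · lift k to ℕ using hk
    have : Finite (Letter k) := by
      refine Set.Finite.to_subtype ((Set.finite_lt_nat k).subset fun c hc ↦ ?_)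
      exact Nat.cast_lt.1 (show (c : ℕ∞) < (k : ℕ∞) from hc)
    exact Language.isRegular_of_finite (Set.finite_range _)

theorem map_bit_append_inj {l m : List Bool} {u v : List Token}
    (hu : ∀ b, u.head? ≠ some (.bit b)) (hv : ∀ b, v.head? ≠ some (.bit b))
    (h : l.map .bit ++ u = m.map .bit ++ v) : l = m ∧ u = v := by
  induction l generalizing m with
  | nil =>
    cases m with
    | nil => exact ⟨rfl, h⟩
    | cons b m => exact (hu b (by rw [List.map_nil, List.nil_append] at h; rw [h]; rfl)).elim
  | cons a l ih =>
    cases m with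
    | nil => exact (hv a (by rw [List.map_nil, List.nil_append] at h; rw [← h]; rfl)).elim
    | cons b m =>
      simp only [List.map_cons, List.cons_append, List.cons.injEq, Token.bit.injEq] at h
      obtain ⟨rfl, rfl⟩ := ih h.2
      exact ⟨by rw [h.1], rfl⟩

theorem Pattern.head?_encode_ne (α : Pattern (Letter k)) (b : Bool) :
    (Pattern.encode α).head? ≠ some (.bit b) := by
  rcases α with _ | ⟨_ | x, α⟩ <;> simp [Pattern.encode, Symbol.encode]

theorem Pattern.encode_injective :
    Function.Injective (Pattern.encode : Pattern (Letter k) → List Token) := by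
  intro α β h
  induction α generalizing β with
  | nil => rcases β with _ | ⟨_ | x, β⟩ <;> simp [Pattern.encode, Symbol.encode] at h ⊢
  | cons s α ih =>
    have hcons (s : Symbol (Letter k)) (α : Pattern (Letter k)) :
      Pattern.encode (s :: α) = Symbol.encode s ++ Pattern.encode α := rfl
    rcases β with _ | ⟨t, β⟩
    · rcases s with _ | x <;> simp [Pattern.encode, Symbol.encode] at h
    rw [hcons, hcons] at h
    rcases s with a | x <;> rcases t with b | y <;>
      simp only [Symbol.encode, List.cons_append, List.cons.injEq, reduceCtorEq, true_and,
        false_and] at h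
    all_goals
      obtain ⟨h₁, h₂⟩ := map_bit_append_inj (Pattern.head?_encode_ne α)
        (Pattern.head?_encode_ne β) h
      rw [ih h₂]
    · rw [Subtype.ext (bits_injective h₁)]
    · rw [bits_injective h₁]

@[simp]
theorem Pattern.encode_append (α β : Pattern (Letter k)) :
    Pattern.encode (α ++ β) = Pattern.encode α ++ Pattern.encode β :=
  List.flatMap_append

theorem Symbol.length_encode_le {α : Pattern (Letter k)} {s : Symbol (Letter k)} (hs : s ∈ α) :
    (Symbol.encode s).length ≤ (Pattern.encode α).length := by
  obtain ⟨β, γ, rfl⟩ := List.append_of_mem hs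
  simp only [Pattern.encode, List.flatMap_append, List.flatMap_cons, List.length_append]
  omega

theorem Pattern.length_le_length_encode (α : Pattern (Letter k)) :
    α.length ≤ (Pattern.encode α).length := by
  induction α with
  | nil => exact le_rfl
  | cons s α ih =>
    rcases s with _ | x <;>
    · simp only [Pattern.encode, Symbol.encode, List.flatMap_cons, List.length_append,
        List.length_cons] at ih ⊢
      omega

/-! ### Annotated patterns -/

/-- A symbol of one side of an equation, together with the image of the symbol under a solution if
it is a variable, and with the claim that the variable is common to both sides or not. -/
inductive Item (k : ℕ∞) : Type
  | const (a : Letter k)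
  | common (x : ℕ) (u : List (Letter k))
  | solo (x : ℕ) (u : List (Letter k))

namespace Item

/-- The symbol without the annotation. -/
def symbol : Item k → Symbol (Letter k)
  | const a => .const a
  | common x _ => .var x
  | solo x _ => .var x

/-- The image of the symbol. -/
def value : Item k → List (Letter k)
  | const a => [a]
  | common _ u => u
  | solo _ u => u

/-- The variable with its image. -/
def pair? : Item k → Option (ℕ × List (Letter k))
  | const _ => none
  | common x u => some (x, u)
  | solo x u => some (x, u)

/-- The variable with its image, if it is claimed to be common to both sides. -/
def common? : Item k → Option (ℕ × List (Letter k))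
  | const _ => none
  | common x u => some (x, u)
  | solo _ _ => none

/-- The variable with its image, if it is claimed not to be common to both sides. -/
def solo? : Item k → Option (ℕ × List (Letter k))
  | const _ => none
  | common _ _ => none
  | solo x u => some (x, u)

theorem vars_map_symbol (I : List (Item k)) :
    Pattern.vars (I.map symbol) = (I.filterMap pair?).map Prod.fst := by
  induction I with
  | nil => rfl
  | cons i I ih => cases i <;> simp [symbol, pair?, ih, List.filterMap_cons]

theorem filterMap_pair?_perm (I : List (Item k)) :
    (I.filterMap pair?).Perm (I.filterMap common? ++ I.filterMap solo?) := by
  induction I with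
  | nil => simp
  | cons i I ih =>
    cases i with
    | const a => exact ih
    | common x u => exact ih.cons _
    | solo x u =>
      simp only [pair?, common?, solo?, List.filterMap_cons]
      exact (ih.cons _).trans List.perm_middle.symm

theorem filterMap_common?_sublist (I : List (Item k)) :
    (I.filterMap common?).Sublist (I.filterMap pair?) := by
  induction I with
  | nil => simp
  | cons i I ih =>
    cases i with
    | const a => exact ih
    | common x u => exact ih.cons_cons _
    | solo x u => exact ih.cons _

theorem filter_map_fst {I : List (Item k)} {p : ℕ → Bool}
    (hc : ∀ q ∈ I.filterMap common?, p q.1 = true)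
    (hs : ∀ q ∈ I.filterMap solo?, p q.1 = false) :
    ((I.filterMap pair?).map Prod.fst).filter p = (I.filterMap common?).map Prod.fst := by
  induction I with
  | nil => simp
  | cons i I ih =>
    cases i with
    | const a => exact ih hc hs
    | common x u =>
      simp only [common?, solo?, pair?, List.filterMap_cons, List.forall_mem_cons] at hc hs ⊢
      simp [hc.1, ih hc.2 hs]
    | solo x u =>
      simp only [common?, solo?, pair?, List.filterMap_cons, List.forall_mem_cons] at hc hs ⊢
      simp [hs.1, ih hc hs.2]

theorem image_map_symbol {I : List (Item k)} {h : ℕ → List (Letter k)}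
    (hh : ∀ q ∈ I.filterMap pair?, h q.1 = q.2) :
    Pattern.image h (I.map symbol) = I.flatMap value := by
  rw [Pattern.image, List.flatMap_map]
  refine List.flatMap_congr fun i hi ↦ ?_
  cases i with
  | const a => rfl
  | common x u => exact hh (x, u) (List.mem_filterMap.2 ⟨_, hi, rfl⟩)
  | solo x u => exact hh (x, u) (List.mem_filterMap.2 ⟨_, hi, rfl⟩)

/-- The annotation of a pattern given by a solution `h` and the set `p` of common variables. -/
def annotate (h : ℕ → List (Letter k)) (p : ℕ → Bool) : Symbol (Letter k) → Item k
  | .const a => const a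
  | .var x => if p x then common x (h x) else solo x (h x)

theorem map_symbol_annotate (h : ℕ → List (Letter k)) (p : ℕ → Bool) (α : Pattern (Letter k)) :
    (α.map (annotate h p)).map symbol = α := by
  rw [List.map_map]
  refine (List.map_congr_left fun s _ ↦ ?_).trans (List.map_id α)
  rcases s with a | x
  · rfl
  · by_cases hx : p x = true <;> simp [annotate, hx, symbol]

theorem flatMap_value_annotate (h : ℕ → List (Letter k)) (p : ℕ → Bool)
    (α : Pattern (Letter k)) : (α.map (annotate h p)).flatMap value = Pattern.image h α := by
  rw [Pattern.image, List.flatMap_map]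
  refine List.flatMap_congr fun s _ ↦ ?_
  rcases s with a | x
  · rfl
  · by_cases hx : p x = true <;> simp [annotate, hx, value, Symbol.image]

theorem pair?_annotate (h : ℕ → List (Letter k)) (p : ℕ → Bool) (α : Pattern (Letter k)) :
    (α.map (annotate h p)).filterMap pair? = (Pattern.vars α).map fun x ↦ (x, h x) := by
  induction α with
  | nil => rfl
  | cons s α ih =>
    rcases s with a | x
    · exact ih
    · rw [List.map_cons]
      by_cases hx : p x = true <;> simp [annotate, hx, pair?, ← ih]

theorem common?_annotate (h : ℕ → List (Letter k)) (p : ℕ → Bool) (α : Pattern (Letter k)) :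
    (α.map (annotate h p)).filterMap common? =
      ((Pattern.vars α).filter p).map fun x ↦ (x, h x) := by
  induction α with
  | nil => rfl
  | cons s α ih =>
    rcases s with a | x
    · exact ih
    · rw [List.map_cons]
      by_cases hx : p x = true <;> simp [annotate, hx, common?, List.filterMap_cons, ← ih]

theorem solo?_annotate (h : ℕ → List (Letter k)) (p : ℕ → Bool) (α : Pattern (Letter k)) :
    (α.map (annotate h p)).filterMap solo? =
      ((Pattern.vars α).filter fun x ↦ !p x).map fun x ↦ (x, h x) := by
  induction α with
  | nil => rfl
  | cons s α ih =>
    rcases s with a | x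
    · exact ih
    · rw [List.map_cons]
      by_cases hx : p x = true <;> simp [annotate, hx, solo?, List.filterMap_cons, ← ih]

end Item

/-- `I` and `J` are annotations of the two sides of a regular-ordered equation that prove that the
equation is satisfiable. -/
structure IsWitness (I J : List (Item k)) : Prop where
  left_ne_nil : I ≠ []
  right_ne_nil : J ≠ []
  value_eq : I.flatMap Item.value = J.flatMap Item.value
  common_eq : I.filterMap Item.common? = J.filterMap Item.common?
  nodup : ((I.filterMap Item.pair? ++ J.filterMap Item.solo?).map Prod.fst).Nodup

theorem IsWitness.mem_regularOrderedSat {I J : List (Item k)} (h : IsWitness I J) :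
    Pattern.encode (I.map Item.symbol) ++ .eq :: Pattern.encode (J.map Item.symbol) ∈
      regularOrderedSat k := by
  classical
  have hnodup := h.nodup
  have hvI := Item.vars_map_symbol I
  have hvJ := Item.vars_map_symbol J
  have hJ : ∀ q ∈ J.filterMap Item.pair?, q ∈ I.filterMap Item.pair? ++ J.filterMap Item.solo? := by
    intro q hq
    rcases List.mem_append.1 ((Item.filterMap_pair?_perm J).mem_iff.1 hq) with hq | hq
    · rw [← h.common_eq] at hq
      exact List.mem_append_left _ ((Item.filterMap_common?_sublist I).subset hq)
    · exact List.mem_append_right _ hq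
  have hinj := List.inj_on_of_nodup_map hnodup
  have hreg : (Pattern.vars (I.map Item.symbol)).Nodup ∧
      (Pattern.vars (J.map Item.symbol)).Nodup := by
    rw [hvI, hvJ]
    refine ⟨hnodup.sublist ((List.sublist_append_left _ _).map _), ?_⟩
    refine (((Item.filterMap_pair?_perm J).map Prod.fst).nodup_iff).2 (hnodup.sublist ?_)
    rw [← h.common_eq]
    exact ((Item.filterMap_common?_sublist I).append (List.Sublist.refl _)).map _
  let E : Equation (Letter k) := ⟨I.map Item.symbol, J.map Item.symbol,
    by simpa using h.left_ne_nil, by simpa using h.right_ne_nil⟩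
  have hE : E.IsRegular := ⟨Pattern.isRegular_iff.2 hreg.1, Pattern.isRegular_iff.2 hreg.2⟩
  refine ⟨E, hE, (Equation.isOrdered_iff hE).2 ?_, ?_, rfl⟩
  · change (Pattern.vars (I.map Item.symbol)).filter (· ∈ Pattern.vars (J.map Item.symbol)) =
      (Pattern.vars (J.map Item.symbol)).filter (· ∈ Pattern.vars (I.map Item.symbol))
    have hcI := (Item.filterMap_common?_sublist I).subset
    have hcJ := (Item.filterMap_common?_sublist J).subset
    rw [List.map_append, List.nodup_append] at hnodup
    have hdisj : ∀ q ∈ J.filterMap Item.solo?, q.1 ∉ (I.filterMap Item.pair?).map Prod.fst :=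
      fun q hq hq' ↦ hnodup.2.2 _ hq' _ (List.mem_map_of_mem hq) rfl
    rw [hvI, hvJ, Item.filter_map_fst, Item.filter_map_fst, h.common_eq]
    · intro q hq
      rw [← h.common_eq] at hq
      exact decide_eq_true (List.mem_map_of_mem (hcI hq))
    · exact fun q hq ↦ decide_eq_false (hdisj q hq)
    · intro q hq
      rw [h.common_eq] at hq
      exact decide_eq_true (List.mem_map_of_mem (hcJ hq))
    · intro q hq
      refine decide_eq_false fun hq' ↦ ?_
      obtain ⟨q', hq', hqq⟩ := List.mem_map.1 hq'
      rcases List.mem_append.1 ((Item.filterMap_pair?_perm J).mem_iff.1 hq') with hq' | hq'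
      · rw [← h.common_eq] at hq'
        have hn := hnodup.1
        rw [((Item.filterMap_pair?_perm I).map Prod.fst).nodup_iff, List.map_append,
          List.nodup_append] at hn
        exact hn.2.2 _ (List.mem_map_of_mem hq') _ (List.mem_map_of_mem hq) hqq
      · refine hdisj q' hq' ?_
        rw [hqq]
        exact List.mem_map_of_mem ((Item.filterMap_pair?_perm I).mem_iff.2
          (List.mem_append_right _ hq))
  · let f (x : ℕ) : List (Letter k) :=
      if hx : ∃ u, (x, u) ∈ I.filterMap Item.pair? ++ J.filterMap Item.solo? then hx.choose else []
    have hf : ∀ q ∈ I.filterMap Item.pair? ++ J.filterMap Item.solo?, f q.1 = q.2 := by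
      intro q hq
      have hx : ∃ u, (q.1, u) ∈ I.filterMap Item.pair? ++ J.filterMap Item.solo? := ⟨q.2, hq⟩
      simp only [f, dif_pos hx]
      exact (Prod.ext_iff.1 (hinj hx.choose_spec hq rfl)).2
    refine ⟨f, ?_⟩
    change Pattern.image f (I.map Item.symbol) = Pattern.image f (J.map Item.symbol)
    rw [Item.image_map_symbol fun q hq ↦ hf q (List.mem_append_left _ hq),
      Item.image_map_symbol fun q hq ↦ hf q (hJ q hq)]
    exact h.value_eq

theorem length_flatMap_le {α β : Type} {l : List α} {f : α → List β} {m n : ℕ}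
    (hl : l.length ≤ m) (hf : ∀ a ∈ l, (f a).length ≤ n) : (l.flatMap f).length ≤ m * n := by
  rw [List.length_flatMap]
  refine (List.sum_le_card_nsmul _ n ?_).trans ?_
  · intro y hy
    obtain ⟨a, ha, rfl⟩ := List.mem_map.1 hy
    exact hf a ha
  · rw [List.length_map, smul_eq_mul]
    exact Nat.mul_le_mul_right _ hl

/-- Each satisfiable regular-ordered equation has a witness in which the encoding of the common
image of the two sides is of cubic length. -/
theorem exists_isWitness {w : List Token} (hw : w ∈ regularOrderedSat k) :
    ∃ I J : List (Item k), IsWitness I J ∧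
      Pattern.encode (I.map Item.symbol) ++ .eq :: Pattern.encode (J.map Item.symbol) = w ∧
      (Pattern.encode ((I.flatMap Item.value).map .const)).length ≤ w.length ^ 3 := by
  obtain ⟨E, hreg, hord, hsat, rfl⟩ := hw
  obtain ⟨h, hsol, hshort⟩ := Equation.exists_short_solution hreg hord hsat
  have hreg' : (Pattern.vars E.lhs).Nodup ∧ (Pattern.vars E.rhs).Nodup :=
    ⟨Pattern.isRegular_iff.1 hreg.1, Pattern.isRegular_iff.1 hreg.2⟩
  let I := E.lhs.map (Item.annotate h fun x ↦ decide (x ∈ Pattern.vars E.rhs))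
  let J := E.rhs.map (Item.annotate h fun x ↦ decide (x ∈ Pattern.vars E.lhs))
  have hval : I.flatMap Item.value = Pattern.image h E.lhs := Item.flatMap_value_annotate ..
  refine ⟨I, J, ⟨?_, ?_, ?_, ?_, ?_⟩, ?_, ?_⟩
  · simpa [I] using E.lhs_ne_nil
  · simpa [J] using E.rhs_ne_nil
  · rw [hval]
    simp only [J, Item.flatMap_value_annotate]
    exact hsol
  · simp only [I, J, Item.common?_annotate, (Equation.isOrdered_iff hreg).1 hord]
  · simp only [I, J, Item.pair?_annotate, Item.solo?_annotate]
    rw [List.map_append, List.map_map, List.map_map]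
    change (List.map id _ ++ List.map id _).Nodup
    rw [List.map_id, List.map_id]
    refine List.nodup_append.2 ⟨hreg'.1, hreg'.2.filter _, ?_⟩
    rintro x hx y hy rfl
    simp [hx] at hy
  · simp only [I, J, Item.map_symbol_annotate]
    rfl
  · rw [hval]
    have hL := Pattern.length_le_length_encode E.lhs
    have hR := Pattern.length_le_length_encode E.rhs
    have hlen : (Pattern.encode E.lhs).length + (Pattern.encode E.rhs).length + 1 =
        E.encode.length := by
      simp only [Equation.encode, List.length_append, List.length_cons]
      omega
    have hsym : ∀ s ∈ E.lhs ++ E.rhs, (Symbol.encode s).length ≤ E.encode.length := by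
      intro s hs
      rcases List.mem_append.1 hs with hs | hs
      · exact (Symbol.length_encode_le hs).trans (by omega)
      · exact (Symbol.length_encode_le hs).trans (by omega)
    have him : (Pattern.image h E.lhs).length ≤ E.encode.length * E.encode.length := by
      refine length_flatMap_le (by omega) fun s hs ↦ ?_
      rcases s with a | x
      · simp only [Symbol.image, List.length_singleton]
        omega
      · exact (hshort x (List.mem_append_left _ (Pattern.mem_vars.2 hs))).1.trans (by omega)
    rw [pow_succ, pow_two]
    refine length_flatMap_le (by rwa [List.length_map]) fun s hs ↦ ?_
    obtain ⟨a, ha, rfl⟩ := List.mem_map.1 hs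
    obtain ⟨s, hs, ha⟩ := List.mem_flatMap.1 ha
    rcases s with b | x
    · simp only [Symbol.image, List.mem_singleton] at ha
      subst ha
      exact hsym _ (List.mem_append_left _ hs)
    · exact hsym _ ((hshort x (List.mem_append_left _ (Pattern.mem_vars.2 hs))).2 a ha)

end WordEq

/-! ### Checking that no name is repeated -/

namespace WordEq

open StackOp
open scoped Computability

/-- The stacks that are used to check that no name is repeated: the names that are still to be
checked or compared, the names that have been compared with the current name, the current name, and
an auxiliary stack which holds the current name in reverse order. -/
inductive NameTape : Type
  | names
  | done
  | cur
  | aux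
  deriving DecidableEq

instance : Fintype NameTape := ⟨{.names, .done, .cur, .aux}, fun k ↦ by cases k <;> decide⟩

/-- The instructions for checking that no name is repeated. -/
inductive NameInstr : Type
  /-- move a symbol from `names` to `cur` -/
  | take (t : Token)
  /-- move a symbol from `cur` to `aux` -/
  | turn (t : Token)
  /-- move the symbol `t` from `names` to `done` and the symbol `u` from `aux` to `cur` -/
  | pair (t u : Token)
  /-- move a symbol from `names` to `done` -/
  | skip (t : Token)
  /-- move a symbol from `aux` to `cur` -/
  | rest (t : Token)
  /-- move a symbol from `done` to `names` -/
  | restore (t : Token)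
  /-- remove a symbol from `cur` -/
  | drop (t : Token)
  /-- test a stack for emptiness -/
  | test (k : NameTape)
  deriving Fintype

namespace NameInstr

/-- The operations on the stacks that an instruction stands for. -/
def op : NameInstr → NameTape → StackOp Token
  | take t, .names => .pop t
  | take t, .cur => .push t
  | turn t, .cur => .pop t
  | turn t, .aux => .push t
  | pair t _, .names => .pop t
  | pair t _, .done => .push t
  | pair _ u, .aux => .pop u
  | pair _ u, .cur => .push u
  | skip t, .names => .pop t
  | skip t, .done => .push t
  | rest t, .aux => .pop t
  | rest t, .cur => .push t
  | restore t, .done => .pop t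
  | restore t, .names => .push t
  | drop t, .cur => .pop t
  | test .names, .names => .empty
  | test .done, .done => .empty
  | test .cur, .cur => .empty
  | test .aux, .aux => .empty
  | _, _ => .nop

/-- The contents of the stacks. -/
structure Stacks : Type where
  names : List Token
  done : List Token
  cur : List Token
  aux : List Token

/-- The sequence of instructions can be executed on `s`, and leads to `s'`. -/
def Exec (c : List NameInstr) (s s' : Stacks) : Prop :=
  Runs (c.map (op · .names)) s.names s'.names ∧ Runs (c.map (op · .done)) s.done s'.done ∧
  Runs (c.map (op · .cur)) s.cur s'.cur ∧ Runs (c.map (op · .aux)) s.aux s'.aux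

theorem exec_append {c d : List NameInstr} {s s' : Stacks} :
    Exec (c ++ d) s s' ↔ ∃ s₁, Exec c s s₁ ∧ Exec d s₁ s' := by
  simp only [Exec, List.map_append, runs_append]
  constructor
  · rintro ⟨⟨a, ha, ha'⟩, ⟨b, hb, hb'⟩, ⟨u, hu, hu'⟩, ⟨v, hv, hv'⟩⟩
    exact ⟨⟨a, b, u, v⟩, ⟨ha, hb, hu, hv⟩, ha', hb', hu', hv'⟩
  · rintro ⟨⟨a, b, u, v⟩, ⟨ha, hb, hu, hv⟩, ha', hb', hu', hv'⟩
    exact ⟨⟨a, ha, ha'⟩, ⟨b, hb, hb'⟩, ⟨u, hu, hu'⟩, ⟨v, hv, hv'⟩⟩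

theorem exec_nil {s s' : Stacks} : Exec [] s s' ↔ s = s' := by
  rcases s with ⟨a, b, u, v⟩
  rcases s' with ⟨a', b', u', v'⟩
  simp [Exec, Runs]

variable {l : List Token} {a b u v : List Token} {s' : Stacks}

theorem exec_take : Exec (l.map take) ⟨a, b, u, v⟩ s' ↔
    ∃ a', a = l ++ a' ∧ s' = ⟨a', b, l.reverse ++ u, v⟩ := by
  rcases s' with ⟨a', b', u', v'⟩
  simp only [Exec, List.map_map, Function.comp_def, op, runs_map_nop, runs_pop, runs_push,
    Stacks.mk.injEq]
  grind

theorem exec_turn : Exec (l.map turn) ⟨a, b, u, v⟩ s' ↔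
    ∃ u', u = l ++ u' ∧ s' = ⟨a, b, u', l.reverse ++ v⟩ := by
  rcases s' with ⟨a', b', u', v'⟩
  simp only [Exec, List.map_map, Function.comp_def, op, runs_map_nop, runs_pop, runs_push,
    Stacks.mk.injEq]
  grind

theorem exec_pair {l : List (Token × Token)} :
    Exec (l.map fun q ↦ pair q.1 q.2) ⟨a, b, u, v⟩ s' ↔
    ∃ a' v', a = l.map Prod.fst ++ a' ∧ v = l.map Prod.snd ++ v' ∧
      s' = ⟨a', (l.map Prod.fst).reverse ++ b, (l.map Prod.snd).reverse ++ u, v'⟩ := by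
  rcases s' with ⟨a', b', u', v'⟩
  simp only [Exec, List.map_map, Function.comp_def, op, runs_map_pop, runs_map_push,
    Stacks.mk.injEq]
  grind

theorem exec_skip : Exec (l.map skip) ⟨a, b, u, v⟩ s' ↔
    ∃ a', a = l ++ a' ∧ s' = ⟨a', l.reverse ++ b, u, v⟩ := by
  rcases s' with ⟨a', b', u', v'⟩
  simp only [Exec, List.map_map, Function.comp_def, op, runs_map_nop, runs_pop, runs_push,
    Stacks.mk.injEq]
  grind

theorem exec_rest : Exec (l.map rest) ⟨a, b, u, v⟩ s' ↔
    ∃ v', v = l ++ v' ∧ s' = ⟨a, b, l.reverse ++ u, v'⟩ := by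
  rcases s' with ⟨a', b', u', v'⟩
  simp only [Exec, List.map_map, Function.comp_def, op, runs_map_nop, runs_pop, runs_push,
    Stacks.mk.injEq]
  grind

theorem exec_restore : Exec (l.map restore) ⟨a, b, u, v⟩ s' ↔
    ∃ b', b = l ++ b' ∧ s' = ⟨l.reverse ++ a, b', u, v⟩ := by
  rcases s' with ⟨a', b', u', v'⟩
  simp only [Exec, List.map_map, Function.comp_def, op, runs_map_nop, runs_pop, runs_push,
    Stacks.mk.injEq]
  grind

theorem exec_drop : Exec (l.map drop) ⟨a, b, u, v⟩ s' ↔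
    ∃ u', u = l ++ u' ∧ s' = ⟨a, b, u', v⟩ := by
  rcases s' with ⟨a', b', u', v'⟩
  simp only [Exec, List.map_map, Function.comp_def, op, runs_map_nop, runs_pop, Stacks.mk.injEq]
  grind

theorem exec_test_names : Exec [test .names] ⟨a, b, u, v⟩ s' ↔ a = [] ∧ s' = ⟨a, b, u, v⟩ := by
  rcases s' with ⟨a', b', u', v'⟩
  simp [Exec, op, Runs, Enabled, apply, Stacks.mk.injEq, and_assoc, eq_comm]

theorem exec_test_done : Exec [test .done] ⟨a, b, u, v⟩ s' ↔ b = [] ∧ s' = ⟨a, b, u, v⟩ := by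
  rcases s' with ⟨a', b', u', v'⟩
  simp [Exec, op, Runs, Enabled, apply, Stacks.mk.injEq]
  grind

theorem exec_test_cur : Exec [test .cur] ⟨a, b, u, v⟩ s' ↔ u = [] ∧ s' = ⟨a, b, u, v⟩ := by
  rcases s' with ⟨a', b', u', v'⟩
  simp [Exec, op, Runs, Enabled, apply, Stacks.mk.injEq]
  grind

theorem exec_test_aux : Exec [test .aux] ⟨a, b, u, v⟩ s' ↔ v = [] ∧ s' = ⟨a, b, u, v⟩ := by
  rcases s' with ⟨a', b', u', v'⟩
  simp [Exec, op, Runs, Enabled, apply, Stacks.mk.injEq]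
  grind

end NameInstr

end WordEq

namespace WordEq

open StackOp
open scoped Computability

/-- The encoding of a variable in reverse order, as it is read from the top of a stack. -/
def revName (w : List Bool) : List Token := w.map .bit ++ [.var]

/-- The encodings of the variables in reverse order, where superfluous zeros are admitted. -/
def revNameLang : Language Token := {y | ∃ w, revName w = y}

theorem length_revName_pos (w : List Bool) : 0 < (revName w).length := by
  simp [revName]

theorem revName_cons (b : Bool) (w : List Bool) : revName (b :: w) = .bit b :: revName w := rfl

theorem revName_append (p w : List Bool) : revName (p ++ w) = p.map .bit ++ revName w := by
  simp [revName]

theorem revName_append_inj {w w' : List Bool} {r r' : List Token}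
    (h : revName w ++ r = revName w' ++ r') : w = w' ∧ r = r' := by
  simp only [revName, List.append_assoc] at h
  obtain ⟨h₁, h₂⟩ := map_bit_append_inj (by simp) (by simp) h
  exact ⟨h₁, by simpa using h₂⟩

theorem flatMap_revName_eq_nil {ws : List (List Bool)} (h : ws.flatMap revName = []) :
    ws = [] := by
  rcases ws with _ | ⟨w, ws⟩
  · rfl
  · simp [revName] at h

theorem flatMap_revName_eq_append {ws : List (List Bool)} {w : List Bool} {r : List Token}
    (h : ws.flatMap revName = revName w ++ r) : ∃ ws', ws = w :: ws' ∧ r = ws'.flatMap revName := by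
  rcases ws with _ | ⟨w', ws⟩
  · simp [revName] at h
  · rw [List.flatMap_cons] at h
    obtain ⟨rfl, rfl⟩ := revName_append_inj h
    exact ⟨ws, rfl, rfl⟩

theorem length_le_length_flatMap_revName (ws : List (List Bool)) :
    ws.length ≤ (ws.flatMap revName).length := by
  induction ws with
  | nil => exact le_rfl
  | cons w ws ih =>
    have := length_revName_pos w
    rw [List.flatMap_cons, List.length_append, List.length_cons]
    omega

/-- Two different names have a first difference. -/
theorem exists_revName_ne {w w' : List Bool} (h : w' ≠ w) :
    ∃ (p : List Bool) (t₀ t : Token) (y r : List Token), t₀ ≠ t ∧ t₀ :: y ∈ revNameLang ∧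
      revName w' = p.map .bit ++ t₀ :: y ∧ revName w = p.map .bit ++ t :: r := by
  induction w' generalizing w with
  | nil =>
    rcases w with _ | ⟨b, w⟩
    · exact (h rfl).elim
    · exact ⟨[], .var, .bit b, [], revName w, by simp, ⟨[], rfl⟩, rfl, rfl⟩
  | cons a w' ih =>
    rcases w with _ | ⟨b, w⟩
    · exact ⟨[], .bit a, .var, revName w', [], by simp, ⟨a :: w', rfl⟩, rfl, rfl⟩
    · by_cases hab : a = b
      · subst hab
        obtain ⟨p, t₀, t, y, r, h₁, h₂, h₃, h₄⟩ := ih fun h' ↦ h (by rw [h'])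
        exact ⟨a :: p, t₀, t, y, r, h₁, h₂, by rw [revName_cons, h₃]; rfl,
          by rw [revName_cons, h₄]; rfl⟩
      · exact ⟨[], .bit a, .bit b, revName w', revName w, by simpa using hab, ⟨a :: w', rfl⟩, rfl,
          rfl⟩

theorem isRegular_revNameLang : revNameLang.IsRegular := by
  have h : revNameLang = Language.map Token.bit ⊤ * {[.var]} := by
    ext w
    rw [Language.mem_mul]
    constructor
    · rintro ⟨l, rfl⟩
      exact ⟨_, Language.mem_map_top_iff.2 ⟨l, rfl⟩, _, rfl, rfl⟩
    · rintro ⟨_, hl, _, rfl, rfl⟩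
      obtain ⟨l, rfl⟩ := Language.mem_map_top_iff.1 hl
      exact ⟨l, rfl⟩
  rw [h]
  exact ((Language.isRegular_top _).map _).mul (Language.isRegular_singleton _)

namespace NameInstr

/-- Comparison of the current name with the next name on `names`: the current name is moved to `aux`
in order to read it from its end, the common prefix `p` is passed, the symbols `t₀` and `t` must be
different, and the rests are moved. -/
def compareLang : Language NameInstr :=
  {c | ∃ (l : List Token) (p : List Bool) (t₀ t : Token) (y r : List Token),
    t₀ ≠ t ∧ t₀ :: y ∈ revNameLang ∧
    l.map turn ++ ([test .cur] ++ ((p.map (fun b ↦ (Token.bit b, Token.bit b)) ++ [(t₀, t)]).map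
      (fun q ↦ pair q.1 q.2) ++ (y.map skip ++ (r.map rest ++ [test .aux])))) = c}

/-- Comparison of the topmost name on `names` with all names below it; afterwards this name is
removed. -/
def rowLang : Language NameInstr :=
  {c | ∃ (y l d : List Token) (m : List NameInstr), y ∈ revNameLang ∧ m ∈ compareLang∗ ∧
    y.map take ++ (m ++ ([test .names] ++ (l.map restore ++ ([test .done] ++
      (d.map drop ++ [test .cur]))))) = c}

/-- Comparison of any two of the names on `names` and `done`. -/
def uniqueLang : Language NameInstr :=
  {c | ∃ (l : List Token) (m : List NameInstr), m ∈ rowLang∗ ∧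
    l.map restore ++ ([test .done] ++ m) = c}

/-- The part of a comparison that treats the first difference and the rest of the next name. -/
def differLang (q : Token × Token) : Language NameInstr :=
  {c | ∃ y, q.1 ≠ q.2 ∧ q.1 :: y ∈ revNameLang ∧ pair q.1 q.2 :: y.map skip = c}

theorem isRegular_differLang (q : Token × Token) : (differLang q).IsRegular := by
  by_cases hq : q.1 = q.2
  · have h : differLang q = 0 := by
      ext c
      exact ⟨fun ⟨_, hne, _⟩ ↦ (hne hq).elim, fun h ↦ (Language.notMem_zero _ h).elim⟩
    rw [h]
    exact Language.isRegular_zero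
  · have h : differLang q = {[pair q.1 q.2]} *
        Language.map skip (revNameLang.leftQuotient [q.1]) := by
      ext c
      rw [Language.mem_mul]
      constructor
      · rintro ⟨y, -, hy, rfl⟩
        exact ⟨_, rfl, _, Language.mem_map_iff.2 ⟨y, hy, rfl⟩, rfl⟩
      · rintro ⟨_, rfl, _, h, rfl⟩
        obtain ⟨y, hy, rfl⟩ := Language.mem_map_iff.1 h
        exact ⟨y, hq, hy, rfl⟩
    rw [h]
    exact (Language.isRegular_singleton _).mul ((isRegular_revNameLang.leftQuotient _).map _)

theorem isRegular_compareLang : compareLang.IsRegular := by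
  have h : compareLang = Language.map turn ⊤ * ({[test .cur]} *
      (Language.map (fun b : Bool ↦ pair (.bit b) (.bit b)) ⊤ * ((⨆ q, differLang q) *
      (Language.map rest ⊤ * {[test .aux]})))) := by
    ext c
    simp only [Language.mem_mul, Language.mem_map_top_iff, Language.mem_iSup]
    constructor
    · rintro ⟨l, p, t₀, t, y, r, hne, hy, rfl⟩
      exact ⟨_, ⟨l, rfl⟩, _, ⟨_, rfl, _, ⟨_, ⟨p, rfl⟩, _, ⟨_, ⟨(t₀, t), y, hne, hy, rfl⟩, _,
        ⟨_, ⟨r, rfl⟩, _, rfl, rfl⟩, rfl⟩, rfl⟩, rfl⟩, by simp⟩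
    · rintro ⟨_, ⟨l, rfl⟩, _, ⟨_, rfl, _, ⟨_, ⟨p, rfl⟩, _, ⟨_, ⟨⟨t₀, t⟩, y, hne, hy, rfl⟩, _,
        ⟨_, ⟨r, rfl⟩, _, rfl, rfl⟩, rfl⟩, rfl⟩, rfl⟩, rfl⟩
      exact ⟨l, p, t₀, t, y, r, hne, hy, by simp⟩
  rw [h]
  exact ((Language.isRegular_top _).map _).mul ((Language.isRegular_singleton _).mul
    (((Language.isRegular_top _).map _).mul ((Language.isRegular_iSup isRegular_differLang).mul
    (((Language.isRegular_top _).map _).mul (Language.isRegular_singleton _)))))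

theorem isRegular_rowLang : rowLang.IsRegular := by
  have h : rowLang = Language.map take revNameLang * (compareLang∗ * ({[test .names]} *
      (Language.map restore ⊤ * ({[test .done]} * (Language.map drop ⊤ * {[test .cur]}))))) := by
    ext c
    simp only [Language.mem_mul, Language.mem_map_top_iff,
      Language.mem_map_iff (L := revNameLang)]
    constructor
    · rintro ⟨y, l, d, m, hy, hm, rfl⟩
      exact ⟨_, ⟨y, hy, rfl⟩, _, ⟨m, hm, _, ⟨_, rfl, _, ⟨_, ⟨l, rfl⟩, _,
        ⟨_, rfl, _, ⟨_, ⟨d, rfl⟩, _, rfl, rfl⟩, rfl⟩, rfl⟩, rfl⟩, rfl⟩, rfl⟩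
    · rintro ⟨_, ⟨y, hy, rfl⟩, _, ⟨m, hm, _, ⟨_, rfl, _, ⟨_, ⟨l, rfl⟩, _,
        ⟨_, rfl, _, ⟨_, ⟨d, rfl⟩, _, rfl, rfl⟩, rfl⟩, rfl⟩, rfl⟩, rfl⟩, rfl⟩
      exact ⟨y, l, d, m, hy, hm, rfl⟩
  rw [h]
  exact (isRegular_revNameLang.map _).mul (isRegular_compareLang.kstar.mul
    ((Language.isRegular_singleton _).mul (((Language.isRegular_top _).map _).mul
    ((Language.isRegular_singleton _).mul (((Language.isRegular_top _).map _).mul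
    (Language.isRegular_singleton _))))))

theorem isRegular_uniqueLang : uniqueLang.IsRegular := by
  have h : uniqueLang = Language.map restore ⊤ * ({[test .done]} * rowLang∗) := by
    ext c
    simp only [Language.mem_mul, Language.mem_map_top_iff]
    constructor
    · rintro ⟨l, m, hm, rfl⟩
      exact ⟨_, ⟨l, rfl⟩, _, ⟨_, rfl, m, hm, rfl⟩, rfl⟩
    · rintro ⟨_, ⟨l, rfl⟩, _, ⟨_, rfl, m, hm, rfl⟩, rfl⟩
      exact ⟨l, m, hm, rfl⟩
  rw [h]
  exact ((Language.isRegular_top _).map _).mul ((Language.isRegular_singleton _).mul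
    isRegular_rowLang.kstar)

variable {w : List Bool} {ws : List (List Bool)} {b : List Token} {s' : Stacks}
  {c : List NameInstr}

theorem exec_compare (hc : c ∈ compareLang)
    (h : Exec c ⟨ws.flatMap revName, b, (revName w).reverse, []⟩ s') :
    ∃ w' ws', ws = w' :: ws' ∧ w' ≠ w ∧
      s' = ⟨ws'.flatMap revName, (revName w').reverse ++ b, (revName w).reverse, []⟩ := by
  obtain ⟨l, p, t₀, t, y, r, hne, ⟨y', hy⟩, rfl⟩ := hc
  obtain ⟨_, h₁, h⟩ := exec_append.1 h
  obtain ⟨u, hu, rfl⟩ := exec_turn.1 h₁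
  obtain ⟨_, h₁, h⟩ := exec_append.1 h
  obtain ⟨rfl, rfl⟩ := exec_test_cur.1 h₁
  obtain ⟨_, h₁, h⟩ := exec_append.1 h
  obtain ⟨a, v, ha, hv, rfl⟩ := exec_pair.1 h₁
  obtain ⟨_, h₁, h⟩ := exec_append.1 h
  obtain ⟨a, rfl, rfl⟩ := exec_skip.1 h₁
  obtain ⟨_, h₁, h⟩ := exec_append.1 h
  obtain ⟨v, rfl, rfl⟩ := exec_rest.1 h₁
  obtain ⟨rfl, rfl⟩ := exec_test_aux.1 h
  rw [List.append_nil] at hu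
  subst hu
  simp only [List.map_append, List.map_map, Function.comp_def, List.map_cons, List.map_nil,
    List.append_assoc, List.append_nil, List.reverse_reverse, List.cons_append,
    List.nil_append] at ha hv ⊢
  rw [← List.cons_append, ← hy, ← List.append_assoc, ← revName_append] at ha
  obtain ⟨ws', rfl, rfl⟩ := flatMap_revName_eq_append ha
  refine ⟨_, ws', rfl, fun hw ↦ hne ?_, ?_⟩
  · rw [← hw, revName_append, hy] at hv
    exact List.head_eq_of_cons_eq (List.append_cancel_left hv)
  · rw [hv, revName_append, hy]
    simp

/-- Comparisons test that the current name differs from the names that are moved to `done`. -/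
theorem exec_compares (hc : c ∈ compareLang∗)
    (h : Exec c ⟨ws.flatMap revName, b, (revName w).reverse, []⟩ s') :
    ∃ us vs, ws = us ++ vs ∧ w ∉ us ∧
      s' = ⟨vs.flatMap revName, (us.flatMap revName).reverse ++ b, (revName w).reverse, []⟩ := by
  obtain ⟨L, rfl, hL⟩ := hc
  induction L generalizing ws b with
  | nil => exact ⟨[], ws, rfl, by simp, (exec_nil.1 h).symm⟩
  | cons c L ih =>
    rw [List.forall_mem_cons] at hL
    obtain ⟨_, h₁, h⟩ := exec_append.1 h
    obtain ⟨w', ws', rfl, hw, rfl⟩ := exec_compare hL.1 h₁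
    obtain ⟨us, vs, rfl, hus, rfl⟩ := ih hL.2 h
    exact ⟨w' :: us, vs, rfl, by simp [hus, hw.symm], by simp⟩

/-- A row tests that the topmost name differs from all names below it. -/
theorem exec_row (hc : c ∈ rowLang) (h : Exec c ⟨ws.flatMap revName, [], [], []⟩ s') :
    ∃ w ws', ws = w :: ws' ∧ w ∉ ws' ∧ s' = ⟨ws'.flatMap revName, [], [], []⟩ := by
  obtain ⟨_, l, d, m, ⟨w, rfl⟩, hm, rfl⟩ := hc
  obtain ⟨_, h₁, h⟩ := exec_append.1 h
  obtain ⟨a, ha, rfl⟩ := exec_take.1 h₁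
  obtain ⟨ws', rfl, rfl⟩ := flatMap_revName_eq_append ha
  obtain ⟨_, h₁, h⟩ := exec_append.1 h
  rw [List.append_nil] at h₁
  obtain ⟨us, vs, rfl, hus, rfl⟩ := exec_compares hm h₁
  obtain ⟨_, h₁, h⟩ := exec_append.1 h
  obtain ⟨hvs, rfl⟩ := exec_test_names.1 h₁
  have hvs' := flatMap_revName_eq_nil hvs
  subst hvs'
  obtain ⟨_, h₁, h⟩ := exec_append.1 h
  obtain ⟨b, hb, rfl⟩ := exec_restore.1 h₁
  obtain ⟨_, h₁, h⟩ := exec_append.1 h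
  obtain ⟨rfl, rfl⟩ := exec_test_done.1 h₁
  obtain ⟨_, h₁, h⟩ := exec_append.1 h
  obtain ⟨u, hu, rfl⟩ := exec_drop.1 h₁
  obtain ⟨rfl, rfl⟩ := exec_test_cur.1 h
  simp only [List.append_nil] at hb
  exact ⟨w, us, by simp, hus, by simp [← hb]⟩

theorem nodup_of_exec_rows (hc : c ∈ rowLang∗)
    (h : Exec c ⟨ws.flatMap revName, [], [], []⟩ ⟨[], [], [], []⟩) : ws.Nodup := by
  obtain ⟨L, rfl, hL⟩ := hc
  induction L generalizing ws with
  | nil =>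
    have h := congrArg Stacks.names (exec_nil.1 h)
    rw [flatMap_revName_eq_nil h]
    exact List.nodup_nil
  | cons c L ih =>
    rw [List.forall_mem_cons] at hL
    obtain ⟨_, h₁, h⟩ := exec_append.1 h
    obtain ⟨w, ws', rfl, hw, rfl⟩ := exec_row hL.1 h₁
    exact List.nodup_cons.2 ⟨hw, ih hL.2 h⟩

theorem exists_exec_compare {w' : List Bool} (h : w' ≠ w) : ∃ c ∈ compareLang,
    c.length ≤ 2 * (revName w).length + 2 + (revName w').length ∧
    Exec c ⟨(w' :: ws).flatMap revName, b, (revName w).reverse, []⟩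
      ⟨ws.flatMap revName, (revName w').reverse ++ b, (revName w).reverse, []⟩ := by
  obtain ⟨p, t₀, t, y, r, hne, hy, h', hw⟩ := exists_revName_ne h
  refine ⟨_, ⟨(revName w).reverse, p, t₀, t, y, r, hne, hy, rfl⟩, ?_, ?_⟩
  · have h₁ := congrArg List.length h'
    have h₂ := congrArg List.length hw
    simp only [List.length_append, List.length_map, List.length_cons, List.length_nil,
      List.length_reverse] at h₁ h₂ ⊢
    omega
  refine exec_append.2 ⟨_, exec_turn.2 ⟨[], (List.append_nil _).symm, rfl⟩, ?_⟩
  refine exec_append.2 ⟨_, exec_test_cur.2 ⟨rfl, rfl⟩, ?_⟩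
  refine exec_append.2 ⟨_, exec_pair.2 ⟨y ++ ws.flatMap revName, r, ?_, ?_, rfl⟩, ?_⟩
  · rw [List.flatMap_cons, h']
    simp
  · rw [List.reverse_reverse, hw]
    simp
  refine exec_append.2 ⟨_, exec_skip.2 ⟨_, rfl, rfl⟩, ?_⟩
  refine exec_append.2 ⟨_, exec_rest.2 ⟨[], (List.append_nil _).symm, rfl⟩, ?_⟩
  refine exec_test_aux.2 ⟨rfl, ?_⟩
  rw [h', hw]
  simp

theorem exists_exec_compares (h : w ∉ ws) : ∃ c ∈ compareLang∗,
    c.length ≤ ws.length * (2 * (revName w).length + 2) + (ws.flatMap revName).length ∧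
    Exec c ⟨ws.flatMap revName, b, (revName w).reverse, []⟩
      ⟨[], (ws.flatMap revName).reverse ++ b, (revName w).reverse, []⟩ := by
  induction ws generalizing b with
  | nil => exact ⟨[], Language.nil_mem_kstar _, by simp, exec_nil.2 rfl⟩
  | cons w' ws ih =>
    rw [List.mem_cons, not_or] at h
    obtain ⟨c, hc, hlen, hex⟩ := exists_exec_compare (b := b) (ws := ws) (Ne.symm h.1)
    obtain ⟨d, hd, hlen', hex'⟩ := ih (b := (revName w').reverse ++ b) h.2
    refine ⟨c ++ d, Language.append_mem_kstar hc hd, ?_, exec_append.2 ⟨_, hex, ?_⟩⟩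
    · rw [List.length_append, List.length_cons, List.flatMap_cons, List.length_append, Nat.succ_mul]
      omega
    · simpa using hex'

theorem exists_exec_row {n : ℕ} (h : w ∉ ws) (hn : ((w :: ws).flatMap revName).length ≤ n) :
    ∃ c ∈ rowLang, c.length ≤ n * (2 * n + 2) + 3 * n + 3 ∧
      Exec c ⟨(w :: ws).flatMap revName, [], [], []⟩ ⟨ws.flatMap revName, [], [], []⟩ := by
  obtain ⟨m, hm, hlen, hex⟩ := exists_exec_compares (b := []) h
  refine ⟨_, ⟨revName w, (ws.flatMap revName).reverse, (revName w).reverse, m, ⟨w, rfl⟩, hm, rfl⟩,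
    ?_, ?_⟩
  · rw [List.flatMap_cons, List.length_append] at hn
    have h₁ := length_le_length_flatMap_revName ws
    have h₂ : ws.length * (2 * (revName w).length + 2) ≤ n * (2 * n + 2) :=
      Nat.mul_le_mul (by omega) (by omega)
    simp only [List.length_append, List.length_map, List.length_cons, List.length_nil,
      List.length_reverse]
    omega
  refine exec_append.2 ⟨_, exec_take.2 ⟨ws.flatMap revName, rfl, rfl⟩, ?_⟩
  rw [List.append_nil]
  refine exec_append.2 ⟨_, hex, ?_⟩
  refine exec_append.2 ⟨_, exec_test_names.2 ⟨rfl, rfl⟩, ?_⟩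
  refine exec_append.2 ⟨_, exec_restore.2 ⟨[], rfl, rfl⟩, ?_⟩
  refine exec_append.2 ⟨_, exec_test_done.2 ⟨rfl, rfl⟩, ?_⟩
  refine exec_append.2 ⟨_, exec_drop.2 ⟨[], (List.append_nil _).symm, rfl⟩, ?_⟩
  exact exec_test_cur.2 ⟨rfl, by simp⟩

theorem exists_exec_rows {n : ℕ} (h : ws.Nodup) (hn : (ws.flatMap revName).length ≤ n) :
    ∃ c ∈ rowLang∗, c.length ≤ ws.length * (n * (2 * n + 2) + 3 * n + 3) ∧
      Exec c ⟨ws.flatMap revName, [], [], []⟩ ⟨[], [], [], []⟩ := by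
  induction ws with
  | nil => exact ⟨[], Language.nil_mem_kstar _, by simp, exec_nil.2 rfl⟩
  | cons w ws ih =>
    rw [List.nodup_cons] at h
    obtain ⟨c, hc, hlen, hex⟩ := exists_exec_row h.1 hn
    obtain ⟨d, hd, hlen', hex'⟩ := ih h.2 (le_trans (by simp) hn)
    refine ⟨c ++ d, Language.append_mem_kstar hc hd, ?_, exec_append.2 ⟨_, hex, hex'⟩⟩
    rw [List.length_append, List.length_cons, Nat.succ_mul]
    omega

theorem reverse_flatMap_encode_var {k : ℕ∞} (l : List ℕ) :
    (Pattern.encode (l.map .var : Pattern (Letter k))).reverse =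
      (l.reverse.map fun x ↦ (Nat.bits x).reverse).flatMap revName := by
  induction l with
  | nil => rfl
  | cons x l ih =>
    have h : Pattern.encode ((x :: l).map .var : Pattern (Letter k)) =
      (.var :: (Nat.bits x).map .bit) ++ Pattern.encode (l.map .var : Pattern (Letter k)) := rfl
    rw [h, List.reverse_append, ih]
    simp [revName]

theorem nodup_reverse_bits_iff {l : List ℕ} :
    (l.reverse.map fun x ↦ (Nat.bits x).reverse).Nodup ↔ l.Nodup := by
  exact (List.nodup_map_iff (List.reverse_injective.comp bits_injective)).trans List.nodup_reverse

variable {k : ℕ∞} {p q : List ℕ}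

/-- Only lists of variables without repetitions pass the test. The names of `p` lie on the stack
`names` with the last name on top, and those of `q` on `done` with the first name on top, so moving
`done` to `names` gives `p ++ q` with the last name on top. -/
theorem nodup_of_exec_unique (hc : c ∈ uniqueLang)
    (h : Exec c ⟨(Pattern.encode (p.map .var : Pattern (Letter k))).reverse,
      Pattern.encode (q.map .var : Pattern (Letter k)), [], []⟩ ⟨[], [], [], []⟩) :
    (p ++ q).Nodup := by
  obtain ⟨l, m, hm, rfl⟩ := hc
  obtain ⟨_, h₁, h⟩ := exec_append.1 h
  obtain ⟨b, hb, rfl⟩ := exec_restore.1 h₁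
  obtain ⟨_, h₁, h⟩ := exec_append.1 h
  obtain ⟨rfl, rfl⟩ := exec_test_done.1 h₁
  rw [List.append_nil] at hb
  rw [← hb, ← List.reverse_append, ← Pattern.encode_append, ← List.map_append,
    reverse_flatMap_encode_var] at h
  exact nodup_reverse_bits_iff.1 (nodup_of_exec_rows hm h)

/-- Lists of variables without repetitions pass the test with a run of polynomial length. -/
theorem exists_exec_unique {n : ℕ} (h : (p ++ q).Nodup)
    (hn : (Pattern.encode ((p ++ q).map .var : Pattern (Letter k))).length ≤ n) :
    ∃ c ∈ uniqueLang, c.length ≤ n + 1 + n * (n * (2 * n + 2) + 3 * n + 3) ∧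
      Exec c ⟨(Pattern.encode (p.map .var : Pattern (Letter k))).reverse,
        Pattern.encode (q.map .var : Pattern (Letter k)), [], []⟩ ⟨[], [], [], []⟩ := by
  have hn' := hn
  rw [← List.length_reverse, reverse_flatMap_encode_var] at hn'
  obtain ⟨m, hm, hlen, hex⟩ := exists_exec_rows (nodup_reverse_bits_iff.2 h) hn'
  have hle := (length_le_length_flatMap_revName _).trans hn'
  have hle' := Nat.mul_le_mul_right (n * (2 * n + 2) + 3 * n + 3) hle
  refine ⟨_, ⟨Pattern.encode (q.map .var : Pattern (Letter k)), m, hm, rfl⟩, ?_, ?_⟩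
  · rw [List.map_append, Pattern.encode_append, List.length_append] at hn
    simp only [List.length_append, List.length_map, List.length_cons, List.length_nil]
    omega
  refine exec_append.2 ⟨_, exec_restore.2 ⟨[], (List.append_nil _).symm, rfl⟩, ?_⟩
  refine exec_append.2 ⟨_, exec_test_done.2 ⟨rfl, rfl⟩, ?_⟩
  rwa [← List.reverse_append, ← Pattern.encode_append, ← List.map_append,
    reverse_flatMap_encode_var]

end NameInstr

end WordEq

/-! ### Certificates -/

namespace WordEq

open StackOp
open scoped Computability

variable {k : ℕ∞}

/-- The parts of an annotated pattern: the constants of the pattern, and the names and the images of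
the variables. -/
inductive Part : Type
  | const
  | commonName
  | commonValue
  | soloName
  | soloValue
  deriving DecidableEq

instance : Fintype Part :=
  ⟨{.const, .commonName, .commonValue, .soloName, .soloValue}, fun c ↦ by cases c <;> decide⟩

namespace Part

/-- The parts that form the encoding of the pattern itself. -/
def isText : Part → Bool
  | const | commonName | soloName => true
  | commonValue | soloValue => false

/-- The parts that form the encoding of the image of the pattern. -/
def isImage : Part → Bool
  | const | commonValue | soloValue => true
  | commonName | soloName => false

/-- The parts that describe the common variables and their images. -/
def isShared : Part → Bool
  | commonName | commonValue => true
  | const | soloName | soloValue => false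

/-- The parts that contain the variables. -/
def isName : Part → Bool
  | commonName | soloName => true
  | const | commonValue | soloValue => false

/-- The part that contains the variables which are not common. -/
def isSoloName : Part → Bool
  | soloName => true
  | const | commonName | commonValue | soloValue => false

end Part

/-- The symbol of a labelled symbol if its label satisfies `p`. -/
def select (p : Part → Bool) (m : Part × Token) : Option Token :=
  if p m.1 then some m.2 else none

/-- The subword of a labelled word formed by the symbols whose labels satisfy `p`. -/
def track (p : Part → Bool) (w : List (Part × Token)) : List Token := w.filterMap (select p)

theorem track_append (p : Part → Bool) (w w' : List (Part × Token)) :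
    track p (w ++ w') = track p w ++ track p w' := List.filterMap_append

theorem track_map_pair (p : Part → Bool) (c : Part) (l : List Token) :
    track p (l.map fun t ↦ (c, t)) = if p c then l else [] := by
  have h : (select p ∘ fun t ↦ (c, t)) = fun t ↦ if p c then some t else none := rfl
  rw [track, List.filterMap_map, h]
  split <;> simp

theorem track_flatMap {α : Type} (p : Part → Bool) (l : List α) (f : α → List (Part × Token)) :
    track p (l.flatMap f) = l.flatMap fun a ↦ track p (f a) := by
  induction l with
  | nil => rfl
  | cons a l ih => rw [List.flatMap_cons, List.flatMap_cons, track_append, ih]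

theorem length_track_le {p q : Part → Bool} (h : ∀ c, p c → q c) (w : List (Part × Token)) :
    (track p w).length ≤ (track q w).length := by
  induction w with
  | nil => exact le_rfl
  | cons m w ih =>
    have := h m.1
    simp only [track, List.filterMap_cons, select] at ih ⊢
    cases hp : p m.1 <;> cases hq : q m.1 <;> simp_all
    omega

theorem length_le_length_track_add {p q : Part → Bool} (h : ∀ c, p c = true ∨ q c = true)
    (w : List (Part × Token)) : w.length ≤ (track p w).length + (track q w).length := by
  induction w with
  | nil => simp
  | cons m w ih =>
    have := h m.1
    simp only [track, List.filterMap_cons, select] at ih ⊢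
    cases hp : p m.1 <;> cases hq : q m.1 <;> simp_all <;> omega

/-- An annotated symbol as a labelled word. -/
def Item.word : Item k → List (Part × Token)
  | const a => (Symbol.encode (Symbol.const a)).map fun t ↦ (.const, t)
  | common x u => ((Symbol.encode (.var x : Symbol (Letter k))).map fun t ↦ (.commonName, t)) ++
      (Pattern.encode (u.map .const)).map fun t ↦ (.commonValue, t)
  | solo x u => ((Symbol.encode (.var x : Symbol (Letter k))).map fun t ↦ (.soloName, t)) ++
      (Pattern.encode (u.map .const)).map fun t ↦ (.soloValue, t)

theorem track_isText (I : List (Item k)) :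
    track Part.isText (I.flatMap Item.word) = Pattern.encode (I.map Item.symbol) := by
  rw [track_flatMap, Pattern.encode, List.flatMap_map]
  refine List.flatMap_congr fun i _ ↦ ?_
  cases i <;> simp [Item.word, track_append, track_map_pair, Part.isText, Item.symbol]

theorem track_isImage (I : List (Item k)) :
    track Part.isImage (I.flatMap Item.word) =
      Pattern.encode ((I.flatMap Item.value).map .const) := by
  rw [track_flatMap, Pattern.encode, List.map_flatMap, List.flatMap_assoc]
  refine List.flatMap_congr fun i _ ↦ ?_
  cases i <;> simp [Item.word, track_append, track_map_pair, Part.isImage, Item.value,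
    Pattern.encode]

theorem encode_cons (s : Symbol (Letter k)) (α : Pattern (Letter k)) :
    Pattern.encode (s :: α) = Symbol.encode s ++ Pattern.encode α := rfl

theorem track_isName (I : List (Item k)) :
    track Part.isName (I.flatMap Item.word) =
      Pattern.encode (((I.filterMap Item.pair?).map Prod.fst).map .var : Pattern (Letter k)) := by
  induction I with
  | nil => rfl
  | cons i I ih =>
    rw [List.flatMap_cons, track_append, ih]
    cases i <;> simp [Item.word, track_append, track_map_pair, Part.isName, Item.pair?,
      List.filterMap_cons, encode_cons]

theorem track_isSoloName (I : List (Item k)) :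
    track Part.isSoloName (I.flatMap Item.word) =
      Pattern.encode (((I.filterMap Item.solo?).map Prod.fst).map .var : Pattern (Letter k)) := by
  induction I with
  | nil => rfl
  | cons i I ih =>
    rw [List.flatMap_cons, track_append, ih]
    cases i <;> simp [Item.word, track_append, track_map_pair, Part.isSoloName, Item.solo?,
      List.filterMap_cons, encode_cons]

/-- A list of variables with their images as a pattern, in which each variable is followed by its
image. -/
def pairsPattern (l : List (ℕ × List (Letter k))) : Pattern (Letter k) :=
  l.flatMap fun q ↦ .var q.1 :: q.2.map .const

theorem track_isShared (I : List (Item k)) :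
    track Part.isShared (I.flatMap Item.word) =
      Pattern.encode (pairsPattern (I.filterMap Item.common?)) := by
  induction I with
  | nil => rfl
  | cons i I ih =>
    rw [List.flatMap_cons, track_append, ih]
    cases i <;> simp [Item.word, track_append, track_map_pair, Part.isShared, Item.common?,
      List.filterMap_cons, encode_cons, pairsPattern]

theorem pairsPattern_injective :
    Function.Injective (pairsPattern : List (ℕ × List (Letter k)) → Pattern (Letter k)) := by
  have key {C : Type} {u v : List C} {α β : Pattern C} (hα : ∀ a, α.head? ≠ some (.const a))
      (hβ : ∀ a, β.head? ≠ some (.const a)) (h : u.map .const ++ α = v.map .const ++ β) :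
      u = v ∧ α = β := by
    induction u generalizing v with
    | nil =>
      rcases v with _ | ⟨b, v⟩
      · exact ⟨rfl, h⟩
      · exact (hα b (by rw [List.map_nil, List.nil_append] at h; rw [h]; rfl)).elim
    | cons a u ih =>
      rcases v with _ | ⟨b, v⟩
      · exact (hβ a (by rw [List.map_nil, List.nil_append] at h; rw [← h]; rfl)).elim
      · simp only [List.map_cons, List.cons_append, List.cons.injEq, Symbol.const.injEq] at h
        obtain ⟨rfl, rfl⟩ := ih h.2
        exact ⟨by rw [h.1], rfl⟩
  have hhead (l : List (ℕ × List (Letter k))) (a : Letter k) :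
      (pairsPattern l).head? ≠ some (.const a) := by
    rcases l with _ | ⟨q, l⟩ <;> simp [pairsPattern]
  intro l m h
  induction l generalizing m with
  | nil => rcases m with _ | ⟨q, m⟩ <;> simp [pairsPattern] at h ⊢
  | cons q l ih =>
    rcases m with _ | ⟨r, m⟩
    · simp [pairsPattern] at h
    · have hcons (q : ℕ × List (Letter k)) (l : List (ℕ × List (Letter k))) :
        pairsPattern (q :: l) = .var q.1 :: (q.2.map .const ++ pairsPattern l) := rfl
      rw [hcons, hcons, List.cons.injEq, Symbol.var.injEq] at h
      obtain ⟨h₁, h₂⟩ := key (hhead l) (hhead m) h.2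
      rw [ih h₂, Prod.ext h.1 h₁]

/-- The labelled words of annotated symbols. -/
def itemLang (k : ℕ∞) : Language (Part × Token) := {w | ∃ i : Item k, i.word = w}

/-- The labelled words of non-empty annotated patterns. -/
def sideLang (k : ℕ∞) : Language (Part × Token) :=
  {w | ∃ I : List (Item k), I ≠ [] ∧ I.flatMap Item.word = w}

theorem mem_kstar_iff_exists_flatMap {α β : Type} {L : Language β} {f : α → List β}
    (hL : ∀ w, w ∈ L ↔ ∃ a, f a = w) {w : List β} : w ∈ L∗ ↔ ∃ l : List α, l.flatMap f = w := by
  constructor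
  · rintro ⟨l, rfl, hl⟩
    induction l with
    | nil => exact ⟨[], rfl⟩
    | cons v l ih =>
      rw [List.forall_mem_cons] at hl
      obtain ⟨a, rfl⟩ := (hL v).1 hl.1
      obtain ⟨m, hm⟩ := ih hl.2
      exact ⟨a :: m, by rw [List.flatMap_cons, hm, List.flatten_cons]⟩
  · rintro ⟨l, rfl⟩
    refine ⟨l.map f, List.flatMap_def, fun y hy ↦ ?_⟩
    obtain ⟨a, -, rfl⟩ := List.mem_map.1 hy
    exact (hL _).2 ⟨a, rfl⟩

theorem mem_kstar_constLang {w : List Token} :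
    w ∈ (constLang k)∗ ↔ ∃ u : List (Letter k), Pattern.encode (u.map .const) = w := by
  rw [mem_kstar_iff_exists_flatMap (L := constLang k) (f := fun a : Letter k ↦ Symbol.encode (.const a))
    fun w ↦ Iff.rfl]
  simp only [Pattern.encode, List.flatMap_map]

theorem isRegular_itemLang (k : ℕ∞) : (itemLang k).IsRegular := by
  have h : itemLang k = Language.map (fun t ↦ (.const, t)) (constLang k) +
      (Language.map (fun t ↦ (.commonName, t)) varLang *
        Language.map (fun t ↦ (.commonValue, t)) (constLang k)∗ +
      Language.map (fun t ↦ (.soloName, t)) varLang *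
        Language.map (fun t ↦ (.soloValue, t)) (constLang k)∗) := by
    ext w
    simp only [Language.mem_add, Language.mem_mul, Language.mem_map_iff, mem_kstar_constLang]
    constructor
    · rintro ⟨a | ⟨x, u⟩ | ⟨x, u⟩, rfl⟩
      · exact Or.inl ⟨_, ⟨a, rfl⟩, rfl⟩
      · exact Or.inr (Or.inl ⟨_, ⟨_, ⟨x, rfl⟩, rfl⟩, _, ⟨_, ⟨u, rfl⟩, rfl⟩, rfl⟩)
      · exact Or.inr (Or.inr ⟨_, ⟨_, ⟨x, rfl⟩, rfl⟩, _, ⟨_, ⟨u, rfl⟩, rfl⟩, rfl⟩)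
    · rintro (⟨_, ⟨a, rfl⟩, rfl⟩ | ⟨_, ⟨_, ⟨x, rfl⟩, rfl⟩, _, ⟨_, ⟨u, rfl⟩, rfl⟩, rfl⟩ |
        ⟨_, ⟨_, ⟨x, rfl⟩, rfl⟩, _, ⟨_, ⟨u, rfl⟩, rfl⟩, rfl⟩)
      · exact ⟨.const a, rfl⟩
      · exact ⟨.common x u, rfl⟩
      · exact ⟨.solo x u, rfl⟩
  rw [h]
  have hc := isRegular_constLang k
  exact (hc.map _).add (((isRegular_varLang.map _).mul (hc.kstar.map _)).add
    ((isRegular_varLang.map _).mul (hc.kstar.map _)))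

theorem isRegular_sideLang (k : ℕ∞) : (sideLang k).IsRegular := by
  have h : sideLang k = itemLang k * (itemLang k)∗ := by
    ext w
    simp only [Language.mem_mul,
      mem_kstar_iff_exists_flatMap (L := itemLang k) (f := Item.word) fun w ↦ Iff.rfl]
    constructor
    · rintro ⟨_ | ⟨i, I⟩, hI, rfl⟩
      · exact (hI rfl).elim
      · exact ⟨_, ⟨i, rfl⟩, _, ⟨I, rfl⟩, rfl⟩
    · rintro ⟨_, ⟨i, rfl⟩, _, ⟨I, rfl⟩, rfl⟩
      exact ⟨i :: I, List.cons_ne_nil _ _, rfl⟩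
  rw [h]
  exact (isRegular_itemLang k).mul (isRegular_itemLang k).kstar

/-- The stacks of the verifier: the input, the left side of the equation, the image of the right
side, the common variables with their images in the right side, and the stacks that are used to
check that no name is repeated. -/
inductive MainTape : Type
  | text
  | lhs
  | image
  | shared
  | name (k : NameTape)
  deriving DecidableEq, Fintype

/-- The instructions of the verifier. The labelled symbols and the symbols that are moved are named by
the instructions, so a certificate contains a whole annotation of the equation. -/
inductive Instr : Type
  /-- read a labelled symbol of the right side -/
  | right (m : Part × Token)
  /-- read the equality sign -/
  | eqSign
  /-- move a symbol from `text` to `lhs` -/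
  | shift (t : Token)
  /-- read a labelled symbol of the left side, and compare it with the symbols of the right side -/
  | left (m : Part × Token)
  /-- execute an instruction for checking that no name is repeated -/
  | check (d : NameInstr)
  deriving Fintype

namespace Instr

/-- The operations on the stacks that an instruction stands for. -/
def op : Instr → MainTape → StackOp Token
  | right m, .text => popOpt (select Part.isText m)
  | right m, .image => pushOpt (select Part.isImage m)
  | right m, .shared => pushOpt (select Part.isShared m)
  | right m, .name .done => pushOpt (select Part.isSoloName m)
  | eqSign, .text => .pop .eq
  | shift t, .text => .pop t
  | shift t, .lhs => .push t
  | left m, .lhs => popOpt (select Part.isText m)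
  | left m, .image => popOpt (select Part.isImage m)
  | left m, .shared => popOpt (select Part.isShared m)
  | left m, .name .names => pushOpt (select Part.isName m)
  | check d, .name k => d.op k
  | _, _ => .nop

/-- A run of the verifier, which reads the right side `w'` of the equation from its end, moves the
left side to another stack, reads the left side `w` from its beginning, and finally executes `d` in
order to check that no name is repeated. -/
def program (w w' : List (Part × Token)) (l : List Token) (d : List NameInstr) : List Instr :=
  w'.reverse.map right ++ ([eqSign] ++ (l.map shift ++ (w.map left ++ d.map check)))

theorem track_reverse (p : Part → Bool) (w : List (Part × Token)) :
    track p w.reverse = (track p w).reverse := List.filterMap_reverse ..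

/-- A run with the input `x` on the stack `text`, whose last symbol is on top, empties all stacks iff
`x` is the equation with the annotated sides `w` and `w'`, the two sides have the same image and the
same common variables with the same images, and the test for repeated names succeeds. -/
theorem runs_program_iff {w w' : List (Part × Token)} {l : List Token} {d : List NameInstr}
    {x : List Token} :
    (∀ k, Runs ((program w w' l d).map (op · k)) (if k = .text then x.reverse else []) []) ↔
      x = l.reverse ++ .eq :: track Part.isText w' ∧ l.reverse = track Part.isText w ∧
      track Part.isImage w' = track Part.isImage w ∧
      track Part.isShared w' = track Part.isShared w ∧
      NameInstr.Exec d ⟨(track Part.isName w).reverse, track Part.isSoloName w', [], []⟩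
        ⟨[], [], [], []⟩ := by
  have hall {P : MainTape → Prop} : (∀ k, P k) ↔ P .text ∧ P .lhs ∧ P .image ∧ P .shared ∧
      P (.name .names) ∧ P (.name .done) ∧ P (.name .cur) ∧ P (.name .aux) :=
    ⟨fun h ↦ ⟨h _, h _, h _, h _, h _, h _, h _, h _⟩,
      fun ⟨h₁, h₂, h₃, h₄, h₅, h₆, h₇, h₈⟩ k ↦ by
        rcases k with _ | _ | _ | _ | _ | _ | _ | _ <;> assumption⟩
  rw [hall]
  simp only [program, List.map_append, List.map_map, Function.comp_def, List.map_cons, List.map_nil,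
    op, runs_append, runs_map_nop, runs_singleton_nop, runs_singleton_pop, runs_map_popOpt, runs_map_pushOpt, runs_pop,
    runs_push, NameInstr.Exec]
  have hx : x.reverse = (track Part.isText w').reverse ++ .eq :: l ↔
      x = l.reverse ++ .eq :: track Part.isText w' := by
    rw [← List.reverse_inj]
    simp
  simp only [← track.eq_def, track_reverse, reduceCtorEq, if_true, if_false, List.append_nil,
    List.reverse_reverse, exists_eq_left', exists_eq_left, exists_eq_right, hx]

end Instr

/-- The certificates: runs of the verifier on annotated sides of an equation. -/
def certLang (k : ℕ∞) : Language Instr :=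
  {c | ∃ w w' l d, w ∈ sideLang k ∧ w' ∈ sideLang k ∧ d ∈ NameInstr.uniqueLang ∧
    Instr.program w w' l d = c}

theorem isRegular_certLang (k : ℕ∞) : (certLang k).IsRegular := by
  have h : certLang k = Language.map Instr.right (sideLang k).reverse * ({[Instr.eqSign]} *
      (Language.map Instr.shift ⊤ * (Language.map Instr.left (sideLang k) *
      Language.map Instr.check NameInstr.uniqueLang))) := by
    ext c
    simp only [Language.mem_mul, Language.mem_map_top_iff, Language.mem_map_iff (L := sideLang k),
      Language.mem_map_iff (L := (sideLang k).reverse),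
      Language.mem_map_iff (L := NameInstr.uniqueLang)]
    constructor
    · rintro ⟨w, w', l, d, hw, hw', hd, rfl⟩
      exact ⟨_, ⟨w'.reverse, Language.reverse_mem_reverse.2 hw', rfl⟩, _, ⟨_, rfl, _, ⟨_, ⟨l, rfl⟩,
        _, ⟨_, ⟨w, hw, rfl⟩, _, ⟨d, hd, rfl⟩, rfl⟩, rfl⟩, rfl⟩, rfl⟩
    · rintro ⟨_, ⟨w', hw', rfl⟩, _, ⟨_, rfl, _, ⟨_, ⟨l, rfl⟩,
        _, ⟨_, ⟨w, hw, rfl⟩, _, ⟨d, hd, rfl⟩, rfl⟩, rfl⟩, rfl⟩, rfl⟩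
      exact ⟨w, w'.reverse, l, d, hw, hw', hd, by rw [Instr.program, List.reverse_reverse]⟩
  rw [h]
  exact ((isRegular_sideLang k).reverse.map _).mul ((Language.isRegular_singleton _).mul
    (((Language.isRegular_top _).map _).mul (((isRegular_sideLang k).map _).mul
    (NameInstr.isRegular_uniqueLang.map _))))

end WordEq

theorem theorem2 (k : ℕ∞) : WordEq.regularOrderedSat k ∈ NP WordEq.Token := by
  open WordEq in
  refine mem_NP_of_runs MainTape.text Instr.op (isRegular_certLang k)
    (2 * (.X + .X ^ 3) + (.X + 1) + (.X + 1 + .X * (.X * (2 * .X + 2) + 3 * .X + 3))) fun x ↦ ?_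
  constructor
  · intro hx
    obtain ⟨I, J, h, rfl, hlen⟩ := exists_isWitness hx
    have hnodup := h.nodup
    rw [List.map_append] at hnodup
    set p := (I.filterMap Item.pair?).map Prod.fst with hp
    set q := (J.filterMap Item.solo?).map Prod.fst with hq
    set w := I.flatMap Item.word with hw
    set w' := J.flatMap Item.word with hw'
    set n := (Pattern.encode (I.map Item.symbol) ++
      .eq :: Pattern.encode (J.map Item.symbol)).length with hn
    have htext : (track Part.isText w).length + (track Part.isText w').length ≤ n := by
      rw [hn, track_isText, track_isText, List.length_append, List.length_cons]
      omega
    have himage : (track Part.isImage w).length ≤ n ^ 3 := by rwa [track_isImage]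
    have himage' : track Part.isImage w' = track Part.isImage w := by
      rw [track_isImage, track_isImage, h.value_eq]
    have hname := length_track_le (p := Part.isName) (q := Part.isText) (by decide) w
    have hsolo := length_track_le (p := Part.isSoloName) (q := Part.isText) (by decide) w'
    obtain ⟨d, hd, hlen', hex⟩ := NameInstr.exists_exec_unique (k := k) (n := n) hnodup (by
      rw [List.map_append, Pattern.encode_append, List.length_append, hp, hq, ← track_isName,
        ← track_isSoloName]
      exact (Nat.add_le_add hname hsolo).trans htext)
    refine ⟨_, ⟨w, w', (track Part.isText w).reverse, d, ⟨I, h.left_ne_nil, rfl⟩,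
      ⟨J, h.right_ne_nil, rfl⟩, hd, rfl⟩, ?_, Instr.runs_program_iff.2 ⟨?_, ?_, ?_, ?_, ?_⟩⟩
    · have h₁ := length_le_length_track_add (p := Part.isText) (q := Part.isImage) (by decide) w
      have h₂ := length_le_length_track_add (p := Part.isText) (q := Part.isImage) (by decide) w'
      rw [himage'] at h₂
      simp only [Instr.program, List.length_append, List.length_map, List.length_reverse,
        List.length_cons, List.length_nil, Polynomial.eval_add, Polynomial.eval_mul,
        Polynomial.eval_pow, Polynomial.eval_X, Polynomial.eval_one, Polynomial.eval_ofNat]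
      omega
    · rw [List.reverse_reverse, track_isText, track_isText]
    · rw [List.reverse_reverse]
    · exact himage'
    · rw [track_isShared, track_isShared, h.common_eq]
    · rwa [track_isName, track_isSoloName]
  · rintro ⟨c, ⟨_, _, l, d, ⟨I, hI, rfl⟩, ⟨J, hJ, rfl⟩, hd, rfl⟩, -, hc⟩
    obtain ⟨hx, hl, himage, hshared, hex⟩ := Instr.runs_program_iff.1 hc
    rw [track_isText] at hx hl
    rw [track_isImage, track_isImage] at himage
    rw [track_isShared, track_isShared] at hshared
    rw [track_isName, track_isSoloName] at hex
    rw [hx, hl]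
    refine IsWitness.mem_regularOrderedSat ⟨hI, hJ, ?_, ?_, ?_⟩
    · exact List.map_injective_iff.2 (fun a b h ↦ Symbol.const.inj h)
        (Pattern.encode_injective himage.symm)
    · exact pairsPattern_injective (Pattern.encode_injective hshared.symm)
    · rw [List.map_append]
      exact NameInstr.nodup_of_exec_unique hd hex
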